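/- Let $n\ge 2$ and let $\mathcal B_m$ be the braid group on $m$ strands with Artin generators $\sigma_1,\dots,\sigma_{m-1}$, where $\sigma_i$ passes the strand in position $i$ over the strand in position $i+1$, and products are read from top to bottom. Finite full $n$-ary trees have their leaves ordered from left to right and addressed by words in the alphabet $\{0,\dots,n-1\}$. For a leaf $w$ of a tree $T$, let $T[w]$ be the tree obtained from $T$ by appending a caret with the $n$ new leaves $w0,\dots,w(n-1)$ at $w$. A braided tree pair is a tuple $(T,\beta,\lambda,T')$, where $T,T'$ are finite full $n$-ary trees with the same number $m$ of leaves, $\beta\in\mathcal B_m$ is a braid from the leaves of $T$ (top) to the leaves of $T'$ (bottom), and $\lambda=\{h_1,\dots,h_m\}$ with $h_i\in\mathcal B_n$ is a labelling of the strands of $\beta$, indexed by the leaves of $T'$. We write $\overrightarrow{Id}$ for the trivial labelling. The expansion of $(T,\beta,\lambda,T')$ along a strand with label $h$ from the leaf $w$ of $T$ to the leaf $w'$ of $T'$ is the braided tree pair with trees $T[w]$ and $T'[w']$ in which the strand is replaced by $n$ parallel strands braided by $h$, each of them labelled by $h$, the other strands keeping their labels. Let $BV_n(\mathcal B_n)$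 be the group of all braided tree pairs modulo the equivalence relation generated by expansions. The product of two elements is computed on representatives $(T,\beta,\lambda,T')$ and $(T',\beta',\lambda',T'')$, which can always be found by expanding, and is represented by $(T,\beta\beta',\lambda'',T'')$, where the label in $\lambda''$ of a strand is the product of the labels of its two parts. Let $R$ be the $n$-ary tree with exactly one caret, and let $R'=R[1]$ if $n=2$ and $R'=R[2]$ if $n\ge 3$. Then $BV_n(\mathcal B_n)$ is generated by the following $2n$ (pairwise distinct) elements: 1. the $n$ standard generators of $F_n$, that is, $(R[n-1],Id,\overrightarrow{Id},R[i])$ for $i=0,\dots,n-2$, and $(R[n-1][(n-1)(n-1)],Id,\overrightarrow{Id},R[n-1][(n-1)0])$; 2. the element $(R',\sigma_{2n-2},\overrightarrow{Id},R')$, with $\sigma_{2n-2}\in\mathcal B_{2n-1}$; 3. the $n-1$ elements $(R,Id,\{\sigma_j,Id,\dots,Id\},R)$ for $j=1,\dots,n-1$, with $\sigma_j\in\mathcal B_n$. -/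

import Mathlib

/-- The Artin relations on generators `σ 0, …, σ (m - 2)` (indices from `0`). -/
def braidRels (m : ℕ) : Set (FreeGroup (Fin (m - 1))) :=
  {w | ∃ i j : Fin (m - 1), i.val + 1 < j.val ∧
      w = .of i * .of j * (.of j * .of i)⁻¹} ∪
  {w | ∃ i j : Fin (m - 1), i.val + 1 = j.val ∧
      w = .of i * .of j * .of i * (.of j * .of i * .of j)⁻¹}

/-- The braid group on `m` strands, by the Artin presentation. Products are read from top to
bottom. -/
abbrev Braid (m : ℕ) : Type := PresentedGroup (braidRels m)

namespace Braid

/-- The Artin generator `σ k`, `0 ≤ k ≤ m - 2`, in which the strand at (0-based) position `k`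
passes over the strand at position `k + 1`. It is the identity when `k` is out of range. -/
def σ (m k : ℕ) : Braid m :=
  if h : k < m - 1 then PresentedGroup.of ⟨k, h⟩ else 1

/-- `s j * s (j + 1) * ⋯ * s (j + k - 1)`. -/
def up {G : Type*} [Monoid G] (s : ℕ → G) (j : ℕ) : ℕ → G
  | 0 => 1
  | k + 1 => up s j k * s (j + k)

/-- `s (j + k - 1) * ⋯ * s (j + 1) * s j`. -/
def down {G : Type*} [Monoid G] (s : ℕ → G) (j : ℕ) : ℕ → G
  | 0 => 1
  | k + 1 => s (j + k) * down s j k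

/-- The first `N` terms of the sequence `s` satisfy the Artin relations. -/
structure ArtinRel {G : Type*} [Monoid G] (s : ℕ → G) (N : ℕ) : Prop where
  comm : ∀ a b, a + 2 ≤ b → b < N → Commute (s a) (s b)
  braid : ∀ a, a + 1 < N → s a * s (a + 1) * s a = s (a + 1) * s a * s (a + 1)

theorem artinRel_σ (m : ℕ) : ArtinRel (σ m) (m - 1) where
  comm a b hab hb := by
    have ha : a < m - 1 := by omega
    simp only [σ, ha, hb, dif_pos]
    have := PresentedGroup.one_of_mem (rels := braidRels m)
      (Or.inl ⟨⟨a, ha⟩, ⟨b, hb⟩, by simp; omega, rfl⟩)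
    simp only [map_mul, map_inv] at this
    exact mul_inv_eq_one.mp this
  braid a ha1 := by
    have ha : a < m - 1 := by omega
    simp only [σ, ha, ha1, dif_pos]
    have := PresentedGroup.one_of_mem (rels := braidRels m)
      (Or.inr ⟨⟨a, ha⟩, ⟨a + 1, ha1⟩, rfl, rfl⟩)
    simp only [map_mul, map_inv] at this
    exact mul_inv_eq_one.mp this

section Ladders

variable {G : Type*} [Monoid G] {s : ℕ → G} {N : ℕ}

theorem commute_up (h : ArtinRel s N) {a j k : ℕ} (hN : j + k ≤ N) (ha : a < N)
    (hf : a + 1 < j ∨ j + k < a) : Commute (s a) (up s j k) := by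
  induction k with
  | zero => exact Commute.one_right _
  | succ k ih =>
    refine Commute.mul_right (ih (by omega) (by omega)) ?_
    rcases hf with hf | hf
    · exact h.comm _ _ (by omega) (by omega)
    · exact (h.comm _ _ (by omega) (by omega)).symm

theorem commute_down (h : ArtinRel s N) {a j k : ℕ} (hN : j + k ≤ N) (ha : a < N)
    (hf : a + 1 < j ∨ j + k < a) : Commute (s a) (down s j k) := by
  induction k with
  | zero => exact Commute.one_right _
  | succ k ih =>
    refine Commute.mul_right ?_ (ih (by omega) (by omega))
    rcases hf with hf | hf
    · exact h.comm _ _ (by omega) (by omega)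
    · exact (h.comm _ _ (by omega) (by omega)).symm

theorem slide_up (h : ArtinRel s N) {a j k : ℕ} (hN : j + k ≤ N) (h1 : j ≤ a)
    (h2 : a + 1 < j + k) : s (a + 1) * up s j k = up s j k * s a := by
  induction k with
  | zero => omega
  | succ k ih =>
    rcases Nat.lt_or_ge (a + 1) (j + k) with h3 | h3
    · rw [up, ← mul_assoc, ih (by omega) h3, mul_assoc, mul_assoc,
        (h.comm a (j + k) (by omega) (by omega)).eq]
    · obtain ⟨k, rfl⟩ : ∃ k', k = k' + 1 := ⟨k - 1, by omega⟩
      obtain rfl : a = j + k := by omega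
      have hc := commute_up h (a := j + k + 1) (j := j) (k := k) (by omega) (by omega) (by omega)
      have hb := h.braid (j + k) (by omega)
      have e : j + (k + 1) = j + k + 1 := by omega
      rw [up, up, e, mul_assoc (up s j k), ← mul_assoc, hc.eq, mul_assoc, mul_assoc,
        ← mul_assoc (s (j + k + 1)), ← hb]

theorem slide_down (h : ArtinRel s N) {a j k : ℕ} (hN : j + k ≤ N) (h1 : j ≤ a)
    (h2 : a + 1 < j + k) : down s j k * s (a + 1) = s a * down s j k := by
  induction k with
  | zero => omega
  | succ k ih =>
    rcases Nat.lt_or_ge (a + 1) (j + k) with h3 | h3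
    · rw [down, mul_assoc, ih (by omega) h3, ← mul_assoc, ← mul_assoc,
        (h.comm a (j + k) (by omega) (by omega)).eq]
    · obtain ⟨k, rfl⟩ : ∃ k', k = k' + 1 := ⟨k - 1, by omega⟩
      obtain rfl : a = j + k := by omega
      have hc := commute_down h (a := j + k + 1) (j := j) (k := k) (by omega) (by omega) (by omega)
      have hb := h.braid (j + k) (by omega)
      have e : j + (k + 1) = j + k + 1 := by omega
      rw [down, down, e, mul_assoc, mul_assoc, ← hc.eq, ← mul_assoc, ← mul_assoc, ← hb]
      simp only [mul_assoc]

theorem up_succ' (s : ℕ → G) (j k : ℕ) : up s j (k + 1) = s j * up s (j + 1) k := by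
  induction k with
  | zero => simp [up]
  | succ k ih => rw [up, ih, up, mul_assoc]; congr 3; omega

theorem down_succ' (s : ℕ → G) (j k : ℕ) : down s j (k + 1) = down s (j + 1) k * s j := by
  induction k with
  | zero => simp [down]
  | succ k ih => rw [down, ih, down, mul_assoc]; congr 2; omega

theorem up_mul_up (h : ArtinRel s N) {j k l : ℕ} (hN : j + k ≤ N) (hl : l + 1 ≤ k) :
    up s (j + 1) l * up s j k = up s j k * up s j l := by
  induction l with
  | zero => simp [up]
  | succ l ih =>
    have e : j + 1 + l = j + l + 1 := by omega
    rw [up, mul_assoc, e, slide_up h hN (by omega) (by omega), ← mul_assoc, ih (by omega),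
      mul_assoc, up]

theorem down_mul_down (h : ArtinRel s N) {j k l : ℕ} (hN : j + k ≤ N) (hl : l + 1 ≤ k) :
    down s j k * down s (j + 1) l = down s j l * down s j k := by
  induction l with
  | zero => simp [down]
  | succ l ih =>
    have e : j + 1 + l = j + l + 1 := by omega
    rw [down, ← mul_assoc, e, slide_down h hN (by omega) (by omega), mul_assoc, ih (by omega),
      ← mul_assoc, down]

theorem down_mul_up (h : ArtinRel s N) {j k l : ℕ} (hN : j + k ≤ N) (hl : l + 1 ≤ k) :
    down s j k * up s (j + 1) l = up s j l * down s j k := by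
  induction l with
  | zero => simp [up]
  | succ l ih =>
    have e : j + 1 + l = j + l + 1 := by omega
    rw [up, ← mul_assoc, ih (by omega), mul_assoc, e, slide_down h hN (by omega) (by omega),
      ← mul_assoc, up]

theorem hexA (h : ArtinRel s N) {j k : ℕ} (hN : j + k + 1 ≤ N) :
    s j * (up s (j + 1) k * up s j k) = up s (j + 1) k * (up s j k * s (j + k)) := by
  have := up_mul_up h (j := j) (k := k + 1) (l := k) (by omega) le_rfl
  change _ = up s (j + 1) k * up s j (k + 1)
  rw [this, up_succ', mul_assoc]

theorem hexC (h : ArtinRel s N) {j k : ℕ} (hN : j + k + 1 ≤ N) :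
    down s j k * (down s (j + 1) k * s j) = s (j + k) * (down s j k * down s (j + 1) k) := by
  have := down_mul_down h (j := j) (k := k + 1) (l := k) (by omega) le_rfl
  rw [← down_succ', ← this, down, mul_assoc]

theorem hexB (h : ArtinRel s N) {j k : ℕ} (hN : j + k + 1 ≤ N) :
    up s j k * (s (j + k) * down s j k) = down s (j + 1) k * (s j * up s (j + 1) k) := by
  have := down_mul_up h (j := j) (k := k + 1) (l := k) (by omega) le_rfl
  change up s j k * down s j (k + 1) = _
  rw [← this, down_succ', mul_assoc]

/-- Two ways of passing a block of `b` strands across a block of `a` strands. -/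
theorem grid (h : ArtinRel s N) {j a b : ℕ} (hN : j + a + b ≤ N + 1) :
    up (fun i => down s i a) j b = down (fun i => up s i b) j a := by
  induction b generalizing a with
  | zero =>
    have : ∀ a, down (fun i => up s i 0) j a = 1 := by
      intro a; induction a with
      | zero => rfl
      | succ a ih => rw [down, ih]; simp [up]
    rw [this]; rfl
  | succ b ih =>
    rw [up, ih (by omega)]
    clear ih
    induction a with
    | zero => simp [down]
    | succ a ih =>
      have hc : ∀ a', a' ≤ a → Commute (s (j + b + a)) (down (fun i => up s i b) j a') := by
        intro a' ha'
        induction a' with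
        | zero => exact Commute.one_right _
        | succ a' ih' =>
          rcases Nat.eq_zero_or_pos b with rfl | hb
          · exact Commute.mul_right (by simp [up]) (ih' (by omega))
          exact Commute.mul_right (commute_up h (by omega) (by omega) (by omega)) (ih' (by omega))
      rw [down, down, down, ← ih (by omega), up]
      have e : j + a + b = j + b + a := by omega
      rw [e]
      have := (hc a le_rfl).eq
      simp only [mul_assoc]
      rw [← mul_assoc (s (j + b + a)), this, mul_assoc]

end Ladders

variable {m : ℕ}

theorem induction_on {P : Braid m → Prop} (β : Braid m) (one : P 1)
    (gen : ∀ j : Fin (m - 1), P (PresentedGroup.of j))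
    (mul : ∀ α β, P α → P β → P (α * β)) (inv : ∀ β, P β → P β⁻¹) : P β := by
  have hβ : β ∈ Subgroup.closure (Set.range (PresentedGroup.of (rels := braidRels m))) := by
    rw [PresentedGroup.closure_range_of]; trivial
  induction hβ using Subgroup.closure_induction with
  | mem x hx => obtain ⟨j, rfl⟩ := hx; exact gen j
  | one => exact one
  | mul x y _ _ hx hy => exact mul x y hx hy
  | inv x _ hx => exact inv x hx

theorem of_eq_σ (j : Fin (m - 1)) : (PresentedGroup.of j : Braid m) = σ m j := by
  simp [σ]

/-- The transposition of the positions `j` and `j + 1`. -/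
def swapAt (j : Fin (m - 1)) : Equiv.Perm (Fin m) :=
  Equiv.swap ⟨j, by omega⟩ ⟨j + 1, by omega⟩

theorem swapAt_val (j : Fin (m - 1)) (r : Fin m) : (swapAt j r).val =
    if r.val = j then j.val + 1 else if r.val = j + 1 then j.val else r.val := by
  simp only [swapAt, Equiv.swap_apply_def, Fin.ext_iff]
  split_ifs <;> rfl

theorem swapAt_comm (i j : Fin (m - 1)) (hij : i.val + 1 < j) (r : Fin m) :
    swapAt i (swapAt j r) = swapAt j (swapAt i r) := by
  ext; simp only [swapAt_val]; grind

theorem swapAt_braid (i j : Fin (m - 1)) (hij : i.val + 1 = j) (r : Fin m) :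
    swapAt i (swapAt j (swapAt i r)) = swapAt j (swapAt i (swapAt j r)) := by
  ext; simp only [swapAt_val]; grind

/-- The underlying permutation: the strand of `β` that ends at the bottom position `r` starts at
the top position `perm β r`. -/
def perm : Braid m →* Equiv.Perm (Fin m) :=
  PresentedGroup.toGroup (f := swapAt) (by
    rintro w (⟨i, j, hij, rfl⟩ | ⟨i, j, hij, rfl⟩) <;>
      simp only [map_mul, map_inv, FreeGroup.lift_apply_of] <;> rw [mul_inv_eq_one] <;>
      refine Equiv.ext fun r => ?_ <;> simp only [Equiv.Perm.mul_apply]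
    · exact swapAt_comm i j hij r
    · exact swapAt_braid i j hij r)

theorem perm_of (j : Fin (m - 1)) : perm (PresentedGroup.of j : Braid m) = swapAt j :=
  PresentedGroup.toGroup.of _

/-- The result of replacing, in the generator `σ j`, the strand that ends at the bottom position
`r` by `d + 1` parallel strands. -/
def cableGen (d : ℕ) (j : Fin (m - 1)) (r : Fin m) : Braid (m + d) :=
  if r.val < j then σ (m + d) (j + d)
  else if r.val = j then up (σ (m + d)) j (d + 1)
  else if r.val = j + 1 then down (σ (m + d)) j (d + 1)
  else σ (m + d) j

/-- The permutation `(r, γ) ↦ (swapAt j r, cableGen d j r * γ)`. -/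
def cableGenAct (d : ℕ) (j : Fin (m - 1)) : Equiv.Perm (Fin m × Braid (m + d)) where
  toFun x := (swapAt j x.1, cableGen d j x.1 * x.2)
  invFun x := ((swapAt j).symm x.1, (cableGen d j ((swapAt j).symm x.1))⁻¹ * x.2)
  left_inv x := by simp
  right_inv x := by simp

theorem cableGen_comm (d : ℕ) (i j : Fin (m - 1)) (hij : i.val + 1 < j) (r : Fin m) :
    cableGen d i (swapAt j r) * cableGen d j r = cableGen d j (swapAt i r) * cableGen d i r := by
  have A := artinRel_σ (m + d)
  have hi := i.isLt
  have hj := j.isLt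
  have e : m + d - 1 = m - 1 + d := by omega
  simp only [cableGen, swapAt_val]
  rcases lt_trichotomy r.val i with h | h | h
  · simp (disch := omega) only [if_pos, if_neg]
    exact A.comm _ _ (by omega) (by omega)
  · simp (disch := omega) only [if_pos, if_neg]
    exact (commute_up A (by omega) (by omega) (by omega)).symm
  rcases eq_or_lt_of_le (Nat.succ_le_of_lt h) with h | h
  · simp (disch := omega) only [if_pos, if_neg]
    exact (commute_down A (by omega) (by omega) (by omega)).symm
  rcases lt_trichotomy r.val j with h | h | h
  · simp (disch := omega) only [if_pos, if_neg]
    exact A.comm _ _ (by omega) (by omega)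
  · simp (disch := omega) only [if_pos, if_neg]
    exact (commute_up A (by omega) (by omega) (by omega))
  rcases eq_or_lt_of_le (Nat.succ_le_of_lt h) with h | h
  · simp (disch := omega) only [if_pos, if_neg]
    exact (commute_down A (by omega) (by omega) (by omega))
  · simp (disch := omega) only [if_neg]
    exact A.comm _ _ (by omega) (by omega)

theorem cableGen_braid (d : ℕ) (i j : Fin (m - 1)) (hij : i.val + 1 = j) (r : Fin m) :
    cableGen d i (swapAt j (swapAt i r)) * (cableGen d j (swapAt i r) * cableGen d i r) =
      cableGen d j (swapAt i (swapAt j r)) * (cableGen d i (swapAt j r) * cableGen d j r) := by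
  have A := artinRel_σ (m + d)
  have hi := i.isLt
  have hj := j.isLt
  have e : m + d - 1 = m - 1 + d := by omega
  simp only [cableGen, swapAt_val, ← hij]
  rcases lt_trichotomy r.val i with h | h | h
  · simp (disch := omega) only [if_pos, if_neg]
    have := A.braid (i.val + d) (by omega)
    rw [show i.val + 1 + d = i.val + d + 1 by omega]
    simpa only [mul_assoc] using this
  · simp (disch := omega) only [if_pos, if_neg, if_true]
    rw [show i.val + 1 + d = i.val + (d + 1) by omega]
    exact hexA A (j := i.val) (k := d + 1) (by omega)
  rcases eq_or_lt_of_le (Nat.succ_le_of_lt h) with h | h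
  · simp (disch := omega) only [if_pos, if_neg]
    rw [show i.val + 1 + d = i.val + (d + 1) by omega]
    exact hexB A (j := i.val) (k := d + 1) (by omega)
  rcases eq_or_lt_of_le (Nat.succ_le_of_lt h) with h | h
  · simp (disch := omega) only [if_pos, if_neg, if_true]
    rw [show i.val + 1 + d = i.val + (d + 1) by omega]
    exact hexC A (j := i.val) (k := d + 1) (by omega)
  · simp (disch := omega) only [if_neg]
    simpa only [mul_assoc] using A.braid i.val (by omega)

/-- The action of the braid group on pairs `(r, γ)` that sends `(r, γ)` to
`(perm β r, cable d r β * γ)`; it encodes `cable`. -/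
def cableAct (d : ℕ) : Braid m →* Equiv.Perm (Fin m × Braid (m + d)) :=
  PresentedGroup.toGroup (f := cableGenAct d) (by
    rintro w (⟨i, j, hij, rfl⟩ | ⟨i, j, hij, rfl⟩) <;>
      simp only [map_mul, map_inv, FreeGroup.lift_apply_of] <;> rw [mul_inv_eq_one] <;>
      refine Equiv.ext fun x => ?_ <;>
      simp only [Equiv.Perm.mul_apply, cableGenAct, Equiv.coe_fn_mk, ← mul_assoc]
    · rw [cableGen_comm d i j hij, swapAt_comm i j hij]
    · have := cableGen_braid d i j hij x.1
      simp only [← mul_assoc] at this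
      rw [this, swapAt_braid i j hij])

/-- The braid obtained from `β` by replacing the strand that ends at the bottom position `r`
by `d + 1` parallel strands. -/
def cable (d : ℕ) (r : Fin m) (β : Braid m) : Braid (m + d) :=
  (cableAct d β (r, 1)).2

theorem cableAct_apply (d : ℕ) (β : Braid m) :
    ∀ r γ, cableAct d β (r, γ) = (perm β r, cable d r β * γ) := by
  induction β using induction_on with
  | one => intro r γ; simp [cable]
  | gen j =>
    have : cableAct d (PresentedGroup.of j : Braid m) = cableGenAct d j :=
      PresentedGroup.toGroup.of _
    intro r γ
    simp [cable, this, perm_of, cableGenAct]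
  | mul α β hα hβ =>
    intro r γ
    have h : ∀ γ, cableAct d (α * β) (r, γ) = (perm α (perm β r),
        cable d (perm β r) α * (cable d r β * γ)) := by
      intro γ; rw [map_mul, Equiv.Perm.mul_apply, hβ, hα]
    have h2 : cable d r (α * β) = _ := congrArg Prod.snd (h 1)
    rw [h, h2]; simp [mul_assoc]
  | inv β hβ =>
    intro r γ
    have h : ∀ γ, cableAct d β⁻¹ (r, γ) = (perm β⁻¹ r, (cable d (perm β⁻¹ r) β)⁻¹ * γ) := by
      intro γ; rw [map_inv, Equiv.Perm.inv_eq_iff_eq, hβ]; simp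
    have h2 : cable d r β⁻¹ = _ := congrArg Prod.snd (h 1)
    rw [h, h2]; simp

theorem cable_of (d : ℕ) (j : Fin (m - 1)) (r : Fin m) :
    cable d r (PresentedGroup.of j : Braid m) = cableGen d j r := by
  have : cableAct d (PresentedGroup.of j : Braid m) = cableGenAct d j :=
    PresentedGroup.toGroup.of _
  simp [cable, this, cableGenAct]

theorem cable_one (d : ℕ) (r : Fin m) : cable d r (1 : Braid m) = 1 := by simp [cable]

theorem cable_mul (d : ℕ) (r : Fin m) (α β : Braid m) :
    cable d r (α * β) = cable d (perm β r) α * cable d r β := by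
  have : cableAct d (α * β) (r, 1) = cableAct d α (cableAct d β (r, 1)) := by
    rw [map_mul, Equiv.Perm.mul_apply]
  rw [cableAct_apply, cableAct_apply, cableAct_apply] at this
  simpa using congrArg Prod.snd this

theorem cable_inv (d : ℕ) (r : Fin m) (β : Braid m) :
    cable d r β⁻¹ = (cable d (perm β⁻¹ r) β)⁻¹ := by
  have h := cable_mul d r β β⁻¹
  rw [mul_inv_cancel, cable_one] at h
  exact eq_inv_of_mul_eq_one_right h.symm
theorem insert_aux (n : ℕ) (r : Fin m) {w} (hw : w ∈ braidRels n) :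
    FreeGroup.lift (fun a : Fin (n - 1) => σ (m + (n - 1)) (r + a)) w = 1 := by
  have A := artinRel_σ (m + (n - 1))
  have hr := r.isLt
  obtain ⟨i, j, hij, rfl⟩ | ⟨i, j, hij, rfl⟩ := hw
  all_goals
    have hi := i.isLt
    have hj := j.isLt
    simp only [map_mul, map_inv, FreeGroup.lift_apply_of]
    rw [mul_inv_eq_one]
  · exact A.comm _ _ (by omega) (by omega)
  · have := A.braid (r.val + i.val) (by omega)
    rwa [add_assoc, hij] at this

/-- The braid on `m + (n - 1)` strands given by the braid `h` on the `n` consecutive positions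
`r, …, r + n - 1`, the remaining strands being vertical. -/
def insert (n : ℕ) (r : Fin m) : Braid n →* Braid (m + (n - 1)) :=
  PresentedGroup.toGroup (f := fun a : Fin (n - 1) => σ (m + (n - 1)) (r + a))
    (fun _ hw => insert_aux n r hw)

theorem insert_of (n : ℕ) (r : Fin m) (a : Fin (n - 1)) :
    insert n r (PresentedGroup.of a) = σ (m + (n - 1)) (r + a) :=
  PresentedGroup.toGroup.of _

/-- The position in the cabled braid of a position `q ≠ r`. -/
def skip (d : ℕ) (r q : Fin m) : Fin (m + d) :=
  ⟨if q.val < r then q else q + d, by split_ifs <;> omega⟩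

/-- The `a`-th position in the cabled braid of the parallel strands replacing `r`. -/
def blk (d : ℕ) (r : Fin m) (a : Fin (d + 1)) : Fin (m + d) := ⟨r + a, by omega⟩

/-- The position in the original braid of the strand at position `x` in the cabled braid:
the positions `r, …, r + d` are all sent to `r`. -/
def collapse (d : ℕ) (r : Fin m) (x : Fin (m + d)) : Fin m :=
  ⟨if x.val < r then x else if x.val ≤ r + d then r else x - d, by split_ifs <;> omega⟩

theorem collapse_skip (d : ℕ) {r q : Fin m} (h : q ≠ r) : collapse d r (skip d r q) = q := by
  have := Fin.val_ne_of_ne h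
  ext; simp only [collapse, skip]; split_ifs <;> omega

theorem collapse_blk (d : ℕ) (r : Fin m) (a) : collapse d r (blk d r a) = r := by
  have := a.isLt
  ext; simp only [collapse, blk]; grind

theorem skip_or_blk (d : ℕ) (r : Fin m) (x : Fin (m + d)) :
    (∃ q, q ≠ r ∧ x = skip d r q) ∨ ∃ a, x = blk d r a := by
  rcases lt_or_ge x.val r with h | h
  · exact Or.inl ⟨⟨x, by omega⟩, by simp [Fin.ext_iff]; omega, by ext; simp [skip, h]⟩
  rcases le_or_gt x.val (r + d) with h' | h'
  · exact Or.inr ⟨⟨x - r, by omega⟩, by ext; simp [blk]; omega⟩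
  · exact Or.inl ⟨⟨x - d, by omega⟩, by simp [Fin.ext_iff]; omega,
      by ext; simp only [skip]; split_ifs <;> omega⟩

theorem perm_σ_val {k : ℕ} (hk : k + 1 < m) (x : Fin m) : (perm (σ m k) x).val =
    if x.val = k then k + 1 else if x.val = k + 1 then k else x.val := by
  have h : k < m - 1 := by omega
  simp only [σ, h, dif_pos, perm_of, swapAt_val]

theorem perm_up_val {j k : ℕ} (hk : j + k < m) (x : Fin m) : (perm (up (σ m) j k) x).val =
    if x.val = j + k then j else if j ≤ x.val ∧ x.val < j + k then x.val + 1 else x.val := by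
  induction k generalizing x with
  | zero => simp only [up, map_one, Equiv.Perm.one_apply]; grind
  | succ k ih =>
    rw [up, map_mul, Equiv.Perm.mul_apply, ih (by omega), perm_σ_val (by omega)]
    grind

theorem perm_down_val {j k : ℕ} (hk : j + k < m) (x : Fin m) : (perm (down (σ m) j k) x).val =
    if x.val = j then j + k else if j < x.val ∧ x.val ≤ j + k then x.val - 1 else x.val := by
  induction k generalizing x with
  | zero => simp only [down, map_one, Equiv.Perm.one_apply]; grind
  | succ k ih =>
    rw [down, map_mul, Equiv.Perm.mul_apply, perm_σ_val (by omega), ih (by omega)]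
    grind

theorem perm_cableGen_val (d : ℕ) (j : Fin (m - 1)) (r : Fin m) (x : Fin (m + d)) :
    (perm (cableGen d j r) x).val =
      if r.val < j then
        (if x.val = j + d then j + d + 1 else if x.val = j + d + 1 then j + d else x.val)
      else if r.val = j then
        (if x.val = j + d + 1 then j.val else if j ≤ x.val ∧ x.val < j + d + 1 then x.val + 1
          else x.val)
      else if r.val = j + 1 then
        (if x.val = j then j + d + 1 else if j < x.val ∧ x.val ≤ j + d + 1 then x.val - 1
          else x.val)
      else if x.val = j then j + 1 else if x.val = j + 1 then j.val else x.val := by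
  have := j.isLt
  unfold cableGen
  split_ifs <;> first
    | (rw [perm_σ_val (by omega)]; grind)
    | (rw [perm_up_val (by omega)]; grind)
    | (rw [perm_down_val (by omega)]; grind)

theorem perm_cable_skip (d : ℕ) (β : Braid m) : ∀ r q : Fin m, q ≠ r →
    perm (cable d r β) (skip d r q) = skip d (perm β r) (perm β q) := by
  induction β using induction_on with
  | one => intro r q _; simp [cable_one]
  | gen j =>
    intro r q h
    have := Fin.val_ne_of_ne h
    rw [cable_of, perm_of]
    ext
    simp only [perm_cableGen_val, skip, swapAt_val]
    grind
  | mul α β hα hβ =>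
    intro r q h
    rw [cable_mul, map_mul, Equiv.Perm.mul_apply, hβ r q h,
      hα _ _ (fun e => h ((perm β).injective e)), map_mul]
    rfl
  | inv β hβ =>
    intro r q h
    rw [cable_inv, map_inv, Equiv.Perm.inv_eq_iff_eq,
      hβ _ _ (fun e => h ((perm β⁻¹).injective e))]
    simp

theorem perm_cable_blk (d : ℕ) (β : Braid m) : ∀ (r : Fin m) (a : Fin (d + 1)),
    perm (cable d r β) (blk d r a) = blk d (perm β r) a := by
  induction β using induction_on with
  | one => intro r a; simp [cable_one]
  | gen j =>
    intro r a
    rw [cable_of, perm_of]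
    ext
    simp only [perm_cableGen_val, blk, swapAt_val]
    grind
  | mul α β hα hβ =>
    intro r a
    rw [cable_mul, map_mul, Equiv.Perm.mul_apply, hβ r a, hα, map_mul]
    rfl
  | inv β hβ =>
    intro r a
    rw [cable_inv, map_inv, Equiv.Perm.inv_eq_iff_eq, hβ]
    simp

theorem collapse_perm_cable (d : ℕ) (β : Braid m) (r : Fin m) (x : Fin (m + d)) :
    collapse d (perm β r) (perm (cable d r β) x) = perm β (collapse d r x) := by
  obtain ⟨q, hq, rfl⟩ | ⟨a, rfl⟩ := skip_or_blk d r x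
  · rw [perm_cable_skip _ _ _ _ hq, collapse_skip d hq,
      collapse_skip d (fun e => hq ((perm β).injective e))]
  · rw [perm_cable_blk, collapse_blk, collapse_blk]

theorem perm_insert_skip (n : ℕ) (r : Fin m) (h : Braid n) : ∀ q : Fin m, q ≠ r →
    perm (insert n r h) (skip (n - 1) r q) = skip (n - 1) r q := by
  induction h using induction_on with
  | one => intro q _; simp
  | gen a =>
    intro q hq
    have := Fin.val_ne_of_ne hq
    have := a.isLt
    rw [insert_of]
    ext
    rw [perm_σ_val (by omega)]
    simp only [skip]
    grind
  | mul α β hα hβ => intro q hq; rw [map_mul, map_mul, Equiv.Perm.mul_apply, hβ q hq, hα q hq]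
  | inv β hβ => intro q hq; rw [map_inv, map_inv, Equiv.Perm.inv_eq_iff_eq, hβ q hq]

theorem collapse_perm_insert (n : ℕ) (r : Fin m) (h : Braid n) (x) :
    collapse (n - 1) r (perm (insert n r h) x) = collapse (n - 1) r x := by
  induction h using induction_on generalizing x with
  | one => simp
  | gen a =>
    have := a.isLt
    rw [insert_of]
    ext
    simp only [collapse]
    rw [perm_σ_val (by omega)]
    grind
  | mul α β hα hβ => rw [map_mul, map_mul, Equiv.Perm.mul_apply, hα, hβ]
  | inv β hβ => rw [← hβ, ← Equiv.Perm.mul_apply, ← map_mul, ← map_mul]; simp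

/-- A braid inserted in the parallel strands slides along them. -/
theorem cable_semiconj_insert (n : ℕ) (β : Braid m) : ∀ (r : Fin m) (h : Braid n),
    SemiconjBy (cable (n - 1) r β) (insert n r h) (insert n (perm β r) h) := by
  induction β using induction_on with
  | one => intro r h; simp [cable_one]
  | gen j =>
    intro r h
    induction h using induction_on with
    | one => simp
    | gen a =>
      have A := artinRel_σ (m + (n - 1))
      have ha := a.isLt
      have hj := j.isLt
      have hr := r.isLt
      rw [insert_of, insert_of, cable_of, perm_of, swapAt_val, cableGen]
      rcases lt_trichotomy r.val j with h | h | h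
      · simp (disch := omega) only [if_pos, if_neg]
        exact (A.comm _ _ (by omega) (by omega)).symm
      · simp (disch := omega) only [if_pos, if_neg]
        rw [h, show j.val + 1 + a.val = j.val + a.val + 1 by omega]
        exact (slide_up A (by omega) (by omega) (by omega)).symm
      rcases eq_or_lt_of_le (Nat.succ_le_of_lt h) with h | h
      · simp (disch := omega) only [if_pos, if_neg]
        rw [← h, show j.val.succ + a.val = j.val + a.val + 1 by omega]
        exact slide_down A (by omega) (by omega) (by omega)
      · simp (disch := omega) only [if_neg]
        exact A.comm _ _ (by omega) (by omega)
    | mul h h' hh hh' => rw [map_mul, map_mul]; exact hh.mul_right hh'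
    | inv h hh => rw [map_inv, map_inv]; exact hh.inv_right
  | mul α β hα hβ =>
    intro r h
    rw [cable_mul, map_mul]
    exact (hα _ h).mul_left (hβ r h)
  | inv β hβ =>
    intro r h
    rw [cable_inv]
    have := hβ (perm β⁻¹ r) h
    rw [show perm β (perm β⁻¹ r) = r by simp] at this
    exact this.inv_symm_left

theorem cable_σ (d : ℕ) {k : ℕ} (hk : k + 1 < m) (r : Fin m) : cable d r (σ m k) =
    if r.val < k then σ (m + d) (k + d) else if r.val = k then up (σ (m + d)) k (d + 1)
    else if r.val = k + 1 then down (σ (m + d)) k (d + 1) else σ (m + d) k := by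
  have h : k < m - 1 := by omega
  simp only [σ, h, dif_pos, cable_of, cableGen]

theorem cable_up_lt (d : ℕ) {j k : ℕ} (hk : j + k < m) (r : Fin m) (h : r.val < j) :
    cable d r (up (σ m) j k) = up (σ (m + d)) (j + d) k := by
  induction k with
  | zero => simp [up, cable_one]
  | succ k ih =>
    have : perm (σ m (j + k)) r = r := by ext; rw [perm_σ_val (by omega)]; grind
    rw [up, cable_mul, this, ih (by omega), cable_σ d (by omega), if_pos (by omega), up,
      show j + d + k = j + k + d by omega]

theorem cable_up_gt (d : ℕ) {j k : ℕ} (r : Fin m) (h : j + k < r.val) :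
    cable d r (up (σ m) j k) = up (σ (m + d)) j k := by
  have := r.isLt
  induction k with
  | zero => simp [up, cable_one]
  | succ k ih =>
    have : perm (σ m (j + k)) r = r := by ext; rw [perm_σ_val (by omega)]; grind
    rw [up, cable_mul, this, ih (by omega), cable_σ d (by omega), if_neg (by omega),
      if_neg (by omega), if_neg (by omega), up]

theorem cable_down_lt (d : ℕ) {j k : ℕ} (hk : j + k < m) (r : Fin m) (h : r.val < j) :
    cable d r (down (σ m) j k) = down (σ (m + d)) (j + d) k := by
  induction k with
  | zero => simp [down, cable_one]
  | succ k ih =>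
    have : perm (down (σ m) j k) r = r := by ext; rw [perm_down_val (by omega)]; grind
    rw [down, cable_mul, this, ih (by omega), cable_σ d (by omega), if_pos (by omega), down,
      show j + d + k = j + k + d by omega]

theorem cable_down_gt (d : ℕ) {j k : ℕ} (r : Fin m) (h : j + k < r.val) :
    cable d r (down (σ m) j k) = down (σ (m + d)) j k := by
  have := r.isLt
  induction k with
  | zero => simp [down, cable_one]
  | succ k ih =>
    have : perm (down (σ m) j k) r = r := by ext; rw [perm_down_val (by omega)]; grind
    rw [down, cable_mul, this, ih (by omega), cable_σ d (by omega), if_neg (by omega),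
      if_neg (by omega), if_neg (by omega), down]

theorem cable_up_end (d : ℕ) {j k : ℕ} (r : Fin m) (h : r.val = j + k) :
    cable d r (up (σ m) j k) = up (fun i => down (σ (m + d)) i (d + 1)) j k := by
  have := r.isLt
  induction k generalizing r with
  | zero => simp [up, cable_one]
  | succ k ih =>
    rw [up, cable_mul, ih _ (by rw [perm_σ_val (by omega)]; grind) (by omega),
      cable_σ d (by omega), if_neg (by omega), if_neg (by omega), if_pos (by omega), up]

theorem cable_down_end (d : ℕ) {j k : ℕ} (hk : j + k < m) (r : Fin m) (h : r.val = j) :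
    cable d r (down (σ m) j k) = down (fun i => up (σ (m + d)) i (d + 1)) j k := by
  induction k with
  | zero => simp [down, cable_one]
  | succ k ih =>
    have hp : (perm (down (σ m) j k) r).val = j + k := by rw [perm_down_val (by omega)]; grind
    rw [down, cable_mul, ih (by omega), cable_σ d (by omega), if_neg (by omega),
      if_pos (by omega), down]

theorem cable_cable_gen (d : ℕ) (j : Fin (m - 1)) (r q : Fin m) (h : r.val < q) :
    cable d (skip d r q) (cableGen d j r) = cable d (skip d q r) (cableGen d j q) := by
  have hj := j.isLt
  have hq := q.isLt
  have hrq : (skip d r q).val = q + d := by simp only [skip]; rw [if_neg (by omega)]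
  have hqr : (skip d q r).val = r := by simp only [skip]; rw [if_pos (by omega)]
  unfold cableGen
  rcases lt_trichotomy r.val j with h1 | h1 | h1
  · rw [if_pos h1, cable_σ d (by omega)]
    rcases lt_trichotomy q.val j with h2 | h2 | h2
    · rw [if_pos (by omega), if_pos (by omega), cable_σ d (by omega), if_pos (by omega)]
    · rw [if_neg (by omega), if_pos (by omega), if_neg (by omega), if_pos (by omega),
        cable_up_lt d (by omega) _ (by omega)]
    rcases eq_or_lt_of_le (Nat.succ_le_of_lt h2) with h2 | h2
    · rw [if_neg (by omega), if_neg (by omega), if_pos (by omega), if_neg (by omega),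
        if_neg (by omega), if_pos (by omega), cable_down_lt d (by omega) _ (by omega)]
    · rw [if_neg (by omega), if_neg (by omega), if_neg (by omega), if_neg (by omega),
        if_neg (by omega), if_neg (by omega), cable_σ d (by omega), if_pos (by omega)]
  · rw [if_neg (by omega), if_pos h1, if_neg (by omega), if_neg (by omega)]
    rcases eq_or_lt_of_le (Nat.succ_le_of_lt h) with h2 | h2
    · rw [if_pos (by omega), cable_up_end d _ (by omega), cable_down_end d (by omega) _ (by omega)]
      exact grid (artinRel_σ _) (by omega)
    · rw [if_neg (by omega), cable_up_gt d _ (by omega), cable_σ d (by omega),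
        if_neg (by omega), if_pos (by omega)]
  · rw [if_neg (by omega), if_neg (by omega)]
    rcases eq_or_lt_of_le (Nat.succ_le_of_lt h1) with h2 | h2
    · rw [if_pos (by omega), if_neg (by omega), if_neg (by omega), if_neg (by omega),
        cable_down_gt d _ (by omega), cable_σ d (by omega), if_neg (by omega), if_neg (by omega),
        if_pos (by omega)]
    · rw [if_neg (by omega), if_neg (by omega), if_neg (by omega), if_neg (by omega),
        cable_σ d (by omega), if_neg (by omega), if_neg (by omega), if_neg (by omega),
        cable_σ d (by omega), if_neg (by omega), if_neg (by omega), if_neg (by omega)]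

/-- Cabling two different strands can be done in either order. -/
theorem cable_cable (d : ℕ) (β : Braid m) : ∀ r q : Fin m, q ≠ r →
    cable d (skip d r q) (cable d r β) = cable d (skip d q r) (cable d q β) := by
  induction β using induction_on with
  | one => intro r q _; simp [cable_one]
  | gen j =>
    intro r q h
    rw [cable_of, cable_of]
    rcases lt_or_gt_of_ne (Fin.val_ne_of_ne h) with h | h
    · exact (cable_cable_gen d j q r h).symm
    · exact cable_cable_gen d j r q h
  | mul α β hα hβ =>
    intro r q h
    rw [cable_mul, cable_mul, perm_cable_skip _ _ _ _ h, hβ r q h,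
      hα _ _ (fun e => h ((perm β).injective e)), cable_mul, cable_mul,
      perm_cable_skip _ _ _ _ h.symm]
  | inv β hβ =>
    intro r q h
    have h' : perm β⁻¹ q ≠ perm β⁻¹ r := fun e => h ((perm β⁻¹).injective e)
    have key : ∀ r q : Fin m, q ≠ r → perm (cable d (perm β⁻¹ r) β)⁻¹ (skip d r q) =
        skip d (perm β⁻¹ r) (perm β⁻¹ q) := by
      intro r q h
      rw [← cable_inv, perm_cable_skip _ _ _ _ h]
    rw [cable_inv, cable_inv, key r q h, hβ _ _ h', cable_inv d q, cable_inv, key q r h.symm]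

theorem cable_insert (n : ℕ) (r q : Fin m) (hq : q ≠ r) (h : Braid n) :
    cable (n - 1) (skip (n - 1) r q) (insert n r h) = insert n (skip (n - 1) q r) h := by
  have hne := Fin.val_ne_of_ne hq
  induction h using induction_on with
  | one => simp [cable_one]
  | gen a =>
    have ha := a.isLt
    have hr := r.isLt
    have hq := q.isLt
    rw [insert_of, insert_of, cable_σ _ (by omega)]
    simp only [skip]
    rcases lt_or_gt_of_ne hne with h | h
    · simp (disch := omega) only [if_pos, if_neg]
      rw [show r.val + a.val + (n - 1) = r.val + (n - 1) + a.val by omega]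
    · simp (disch := omega) only [if_pos, if_neg]
  | mul α β hα hβ =>
    rw [map_mul, cable_mul, perm_insert_skip _ _ _ _ hq, hα, hβ, map_mul]
  | inv β hβ =>
    rw [map_inv, cable_inv, ← map_inv, perm_insert_skip _ _ _ _ hq, hβ, map_inv]

theorem insert_commute (n : ℕ) (r q : Fin m) (hq : q ≠ r) (h h' : Braid n) :
    Commute (insert n (skip (n - 1) q r) h) (insert n (skip (n - 1) r q) h') := by
  have hne := Fin.val_ne_of_ne hq
  induction h using induction_on with
  | one => simp
  | gen a =>
    induction h' using induction_on with
    | one => simp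
    | gen b =>
      have A := artinRel_σ (m + (n - 1) + (n - 1))
      have ha := a.isLt
      have hb := b.isLt
      have hr := r.isLt
      have hq := q.isLt
      rw [insert_of, insert_of]
      simp only [skip]
      rcases lt_or_gt_of_ne hne with h | h
      · simp (disch := omega) only [if_pos, if_neg]
        exact (A.comm _ _ (by omega) (by omega)).symm
      · simp (disch := omega) only [if_pos, if_neg]
        exact A.comm _ _ (by omega) (by omega)
    | mul α β hα hβ => rw [map_mul]; exact hα.mul_right hβ
    | inv β hβ => rw [map_inv]; exact hβ.inv_right
  | mul α β hα hβ => rw [map_mul]; exact hα.mul_left hβ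
  | inv β hβ => rw [map_inv]; exact hβ.inv_left

theorem collapse_collapse (d : ℕ) (r q : Fin m) (h : q ≠ r) (x) :
    collapse d r (collapse d (skip d r q) x) = collapse d q (collapse d (skip d q r) x) := by
  have := Fin.val_ne_of_ne h
  ext
  simp only [collapse, skip]
  grind

end Braid

/-- Finite full `n`-ary trees: every vertex has no children or exactly `n` ordered children. -/
inductive NTree (n : ℕ) : Type
  | leaf : NTree n
  | node (c : Fin n → NTree n) : NTree n

namespace NTree

variable {n : ℕ}

/-- The leaves of a tree from left to right, as words in the alphabet `{0, …, n - 1}` that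
describe the path from the root. -/
def leaves : NTree n → List (List (Fin n))
  | leaf => [[]]
  | node c => (List.finRange n).flatMap fun k => (c k).leaves.map (List.cons k)

/-- The tree `T[w]` obtained from `T` by appending a caret to the leaf `w`. (If `w` is not a leaf
of `T`, the tree is unchanged.) -/
def expand : NTree n → List (Fin n) → NTree n
  | leaf, [] => node fun _ => leaf
  | leaf, _ :: _ => leaf
  | node c, [] => node c
  | node c, k :: w => node (Function.update c k ((c k).expand w))

/-- The word `w` is the address of a vertex that is not a leaf. -/
def IsInner : NTree n → List (Fin n) → Prop
  | leaf, _ => False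
  | node _, [] => True
  | node c, k :: w => (c k).IsInner w

theorem nil_mem_leaves_node (c : Fin n → NTree n) : [] ∉ (node c).leaves := by
  simp [leaves]

theorem cons_mem_leaves_node {c : Fin n → NTree n} {k : Fin n} {w : List (Fin n)} :
    k :: w ∈ (node c).leaves ↔ w ∈ (c k).leaves := by
  simp [leaves]

theorem leaves_expand (T : NTree n) {w : List (Fin n)} (hw : w ∈ T.leaves) :
    ∃ A B, T.leaves = A ++ w :: B ∧
      (T.expand w).leaves = A ++ (List.finRange n).map (fun k => w ++ [k]) ++ B := by
  induction T generalizing w with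
  | leaf =>
    simp only [leaves, List.mem_singleton] at hw
    subst hw
    refine ⟨[], [], rfl, ?_⟩
    simp [expand, leaves]
    rw [List.map_eq_flatMap]
  | node c ih =>
    cases w with
    | nil => exact absurd hw (nil_mem_leaves_node c)
    | cons k w =>
      rw [cons_mem_leaves_node] at hw
      obtain ⟨A, B, h1, h2⟩ := ih k hw
      obtain ⟨X, Y, hXY⟩ := List.append_of_mem (List.mem_finRange k)
      have hnd := List.nodup_finRange n
      rw [hXY, List.nodup_middle, List.nodup_cons, List.mem_append, not_or] at hnd
      have hu : ∀ Z : List (Fin n), k ∉ Z →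
          (Z.flatMap fun l => (Function.update c k ((c k).expand w) l).leaves.map (List.cons l)) =
            Z.flatMap fun l => (c l).leaves.map (List.cons l) := by
        intro Z hZ
        refine List.flatMap_congr fun l hl => ?_
        rw [Function.update_of_ne (fun e : l = k => hZ (e ▸ hl))]
      refine ⟨X.flatMap (fun l => (c l).leaves.map (List.cons l)) ++ A.map (List.cons k),
        B.map (List.cons k) ++ Y.flatMap (fun l => (c l).leaves.map (List.cons l)), ?_, ?_⟩
      · rw [leaves, hXY]; simp [h1]
      · have := hu X hnd.1.1
        have := hu Y hnd.1.2
        rw [expand, leaves]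
        conv_lhs => rw [hXY]
        rw [List.flatMap_append, List.flatMap_cons, hu X hnd.1.1, hu Y hnd.1.2,
          Function.update_self, h2]
        simp

theorem nodup_leaves (T : NTree n) : T.leaves.Nodup := by
  induction T with
  | leaf => simp [leaves]
  | node c ih =>
    rw [leaves, List.nodup_flatMap]
    refine ⟨fun k _ => (ih k).map (List.cons_injective), ?_⟩
    refine (List.nodup_finRange n).imp ?_
    intro a b hab
    rw [Function.onFun, List.disjoint_left]
    simp only [List.mem_map]
    rintro _ ⟨u, _, rfl⟩ ⟨v, _, h⟩
    exact hab (List.cons.inj h).1.symm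

theorem isInner_expand (T : NTree n) {w : List (Fin n)} (hw : w ∈ T.leaves) (v : List (Fin n)) :
    (T.expand w).IsInner v ↔ v = w ∨ T.IsInner v := by
  induction T generalizing w v with
  | leaf =>
    simp only [leaves, List.mem_singleton] at hw
    subst hw
    cases v <;> simp [expand, IsInner]
  | node c ih =>
    cases w with
    | nil => exact absurd hw (nil_mem_leaves_node c)
    | cons k w =>
      rw [cons_mem_leaves_node] at hw
      cases v with
      | nil => simp [expand, IsInner]
      | cons l v =>
        rcases eq_or_ne l k with rfl | h
        · simp [expand, IsInner, ih l hw v]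
        · simp [expand, IsInner, h]

theorem not_isInner_of_mem (T : NTree n) {w : List (Fin n)} (hw : w ∈ T.leaves) :
    ¬ T.IsInner w := by
  induction T generalizing w with
  | leaf => simp [IsInner]
  | node c ih =>
    cases w with
    | nil => exact absurd hw (nil_mem_leaves_node c)
    | cons k w => exact ih k (cons_mem_leaves_node.mp hw)

theorem ext_isInner {T S : NTree n} (h : ∀ w, T.IsInner w ↔ S.IsInner w) : T = S := by
  induction T generalizing S with
  | leaf =>
    cases S with
    | leaf => rfl
    | node c => simpa [IsInner] using h []
  | node c ih =>
    cases S with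
    | leaf => simpa [IsInner] using h []
    | node c' => congr 1; funext k; exact ih k fun w => h (k :: w)

theorem mem_leaves_expand (T : NTree n) {w v : List (Fin n)} (hw : w ∈ T.leaves)
    (hv : v ∈ T.leaves) (h : v ≠ w) : v ∈ (T.expand w).leaves := by
  obtain ⟨A, B, h1, h2⟩ := T.leaves_expand hw
  rw [h1] at hv
  rw [h2]
  simp only [List.mem_append, List.mem_cons] at hv ⊢
  tauto

theorem expand_comm (T : NTree n) {w v : List (Fin n)} (hw : w ∈ T.leaves)
    (hv : v ∈ T.leaves) (h : v ≠ w) : (T.expand w).expand v = (T.expand v).expand w := by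
  refine ext_isInner fun u => ?_
  rw [isInner_expand _ (T.mem_leaves_expand hw hv h), isInner_expand _ hw,
    isInner_expand _ (T.mem_leaves_expand hv hw h.symm), isInner_expand _ hv]
  tauto

theorem length_leaves_expand [NeZero n] (T : NTree n) {w : List (Fin n)} (hw : w ∈ T.leaves) :
    (T.expand w).leaves.length = T.leaves.length + (n - 1) := by
  obtain ⟨A, B, h1, h2⟩ := T.leaves_expand hw
  have := NeZero.pos n
  rw [h1, h2]
  simp
  omega

/-- One tree is obtained from another by appending a caret to a leaf. -/
def Step (T S : NTree n) : Prop := ∃ w ∈ T.leaves, S = T.expand w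

theorem Step.node {c : Fin n → NTree n} {k : Fin n} {S : NTree n} (h : Step (c k) S) :
    Step (node c) (node (Function.update c k S)) := by
  obtain ⟨w, hw, rfl⟩ := h
  exact ⟨k :: w, cons_mem_leaves_node.mpr hw, rfl⟩

theorem steps_update {c : Fin n → NTree n} {k : Fin n} {S : NTree n}
    (h : Relation.ReflTransGen Step (c k) S) :
    Relation.ReflTransGen Step (NTree.node c) (NTree.node (Function.update c k S)) := by
  induction h with
  | refl => rw [Function.update_eq_self]
  | @tail A B _ hAB ih =>
    refine ih.tail ?_
    have := Step.node (c := Function.update c k A) (k := k) (S := B)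
      (by rwa [Function.update_self])
    rwa [Function.update_idem] at this

theorem steps_node {c c' : Fin n → NTree n} (h : ∀ k, Relation.ReflTransGen Step (c k) (c' k)) :
    Relation.ReflTransGen Step (node c) (node c') := by
  classical
  have key : ∀ s : Finset (Fin n),
      Relation.ReflTransGen Step (node c) (node fun k => if k ∈ s then c' k else c k) := by
    intro s
    induction s using Finset.induction_on with
    | empty => simpa using Relation.ReflTransGen.refl
    | insert a s ha ih =>
      refine ih.trans ?_
      have := steps_update (c := fun k => if k ∈ s then c' k else c k) (k := a) (S := c' a)
        (by simpa [ha] using h a)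
      convert this using 2
      funext k
      rcases eq_or_ne k a with rfl | hk
      · simp
      · simp [hk]
  simpa using key Finset.univ

theorem steps_from_leaf (T : NTree n) : Relation.ReflTransGen Step leaf T := by
  induction T with
  | leaf => exact .refl
  | node c ih =>
    exact (Relation.ReflTransGen.single ⟨[], by simp [leaves], rfl⟩).trans (steps_node ih)

theorem exists_common (T S : NTree n) : ∃ U, Relation.ReflTransGen Step T U ∧
    Relation.ReflTransGen Step S U := by
  induction T generalizing S with
  | leaf => exact ⟨S, steps_from_leaf S, .refl⟩
  | node c ih =>
    cases S with
    | leaf => exact ⟨_, .refl, steps_from_leaf _⟩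
    | node c' =>
      choose U h1 h2 using fun k => ih k (c' k)
      exact ⟨node U, steps_node h1, steps_node h2⟩

theorem isInner_of_steps {T S : NTree n} (h : Relation.ReflTransGen Step T S) {w}
    (hw : T.IsInner w) : S.IsInner w := by
  induction h with
  | refl => exact hw
  | tail _ h ih =>
    obtain ⟨v, hv, rfl⟩ := h
    exact (isInner_expand _ hv _).mpr (Or.inr ih)

/-- The `i`-th leaf, from left to right, of a tree with `m` leaves. -/
def leafAt (T : NTree n) {m : ℕ} (h : T.leaves.length = m) (i : Fin m) : List (Fin n) :=
  T.leaves[i.val]'(by omega)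

theorem leafAt_mem (T : NTree n) {m : ℕ} (h : T.leaves.length = m) (i : Fin m) :
    T.leafAt h i ∈ T.leaves := List.getElem_mem _

theorem leafAt_injective (T : NTree n) {m : ℕ} (h : T.leaves.length = m) {i j : Fin m}
    (e : T.leafAt h i = T.leafAt h j) : i = j :=
  Fin.ext ((T.nodup_leaves.getElem_inj_iff).mp e)

theorem exists_leafAt (T : NTree n) {m : ℕ} (h : T.leaves.length = m) {w} (hw : w ∈ T.leaves) :
    ∃ i, T.leafAt h i = w := by
  obtain ⟨i, hi, rfl⟩ := List.getElem_of_mem hw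
  exact ⟨⟨i, by omega⟩, rfl⟩

theorem getElem_splice {α : Type*} {L L' A B C : List α} {w : α} (h1 : L = A ++ w :: B)
    (h2 : L' = A ++ C ++ B) {i j x : ℕ} (hA : A.length = i) (hC : 0 < C.length) (hij : j ≠ i)
    (hj : j < L.length) (hx : x < L'.length) (e : x = if j < i then j else j + (C.length - 1)) :
    L'[x] = L[j] := by
  subst h1 h2 hA
  rcases lt_or_gt_of_ne hij with hlt | hlt
  · obtain rfl : x = j := by rw [e, if_pos hlt]
    rw [List.getElem_append_left (by simp; omega), List.getElem_append_left hlt,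
      List.getElem_append_left hlt]
  · obtain rfl : x = j + (C.length - 1) := by rw [e, if_neg (by omega)]
    rw [List.getElem_append_right (by simp; omega), List.getElem_append_right (by omega),
      List.getElem_cons, dif_neg (by omega)]
    congr 1
    simp
    omega

theorem leafAt_expand [NeZero n] (T : NTree n) {m : ℕ} (h : T.leaves.length = m) (i j : Fin m)
    (hij : j ≠ i) (h' : (T.expand (T.leafAt h i)).leaves.length = m + (n - 1)) :
    (T.expand (T.leafAt h i)).leafAt h' (Braid.skip (n - 1) i j) = T.leafAt h j := by
  obtain ⟨A, B, h1, h2⟩ := T.leaves_expand (T.leafAt_mem h i)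
  have hn := NeZero.pos n
  have hne := Fin.val_ne_of_ne hij
  have hA : A.length = i := by
    have hA' : A.length < T.leaves.length := by rw [h1]; simp
    refine (T.nodup_leaves.getElem_inj_iff (hi := hA') (hj := by omega)).mp ?_
    have : T.leaves[A.length] = T.leafAt h i := by simp [h1]
    rw [this]; rfl
  exact getElem_splice h1 h2 hA (by simpa using hn) hne (by omega) _ (by simp [Braid.skip])

end NTree

/-- A braided tree pair `(T, β, λ, T')` on `m` strands: two finite full `n`-ary trees with `m`
leaves, a braid on `m` strands that connects the leaves of `T` (top) to those of `T'` (bottom), and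
a label in the braid group on `n` strands (the type of a recursive braid) on each strand. The labels
are indexed by the bottom ends of the strands. -/
structure TreePair (n m : ℕ) where
  dom : NTree n
  ran : NTree n
  dom_leaves : dom.leaves.length = m
  ran_leaves : ran.leaves.length = m
  braid : Braid m
  labels : Fin m → Braid n

namespace TreePair

variable {n m : ℕ}

/-- The leaf of the domain tree at which the strand ending at the leaf `r` of the range tree
starts. -/
def topLeaf (a : TreePair n m) (r : Fin m) : List (Fin n) :=
  a.dom.leafAt a.dom_leaves (Braid.perm a.braid r)

/-- The `r`-th leaf of the range tree. -/
def botLeaf (a : TreePair n m) (r : Fin m) : List (Fin n) :=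
  a.ran.leafAt a.ran_leaves r

theorem topLeaf_mem (a : TreePair n m) (r : Fin m) : a.topLeaf r ∈ a.dom.leaves :=
  NTree.leafAt_mem _ _ _

theorem botLeaf_mem (a : TreePair n m) (r : Fin m) : a.botLeaf r ∈ a.ran.leaves :=
  NTree.leafAt_mem _ _ _

/-- The expansion of a braided tree pair along the strand that ends at the `r`-th leaf of the range
tree, with label `h`: carets are appended to both trees at the ends of the strand, the strand is
replaced by `n` parallel strands braided by `h`, and each of the new strands has the label `h`. -/
def expand [NeZero n] (a : TreePair n m) (r : Fin m) : TreePair n (m + (n - 1)) where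
  dom := a.dom.expand (a.topLeaf r)
  ran := a.ran.expand (a.botLeaf r)
  dom_leaves := by rw [NTree.length_leaves_expand _ (a.topLeaf_mem r), a.dom_leaves]
  ran_leaves := by rw [NTree.length_leaves_expand _ (a.botLeaf_mem r), a.ran_leaves]
  braid := Braid.cable (n - 1) r a.braid * Braid.insert n r (a.labels r)
  labels := fun x => a.labels (Braid.collapse (n - 1) r x)

/-- The composition `(T, ββ', λλ', T'')` of the braided tree pairs `(T, β, λ, T')` and
`(T', β', λ', T'')`; the label of a strand is the product of the labels along it. -/
def comp (a b : TreePair n m) (_h : a.ran = b.dom) : TreePair n m where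
  dom := a.dom
  ran := b.ran
  dom_leaves := a.dom_leaves
  ran_leaves := b.ran_leaves
  braid := a.braid * b.braid
  labels := fun r => a.labels (Braid.perm b.braid r) * b.labels r

/-- The trivial braided tree pair `(T, Id, Id, T)`. -/
def refl (T : NTree n) (h : T.leaves.length = m) : TreePair n m := ⟨T, T, h, h, 1, fun _ => 1⟩

/-- The inverse of `(T, β, λ, T')`. -/
def inv (a : TreePair n m) : TreePair n m :=
  ⟨a.ran, a.dom, a.ran_leaves, a.dom_leaves, a.braid⁻¹,
    fun r => (a.labels (Braid.perm a.braid⁻¹ r))⁻¹⟩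

theorem ext' {T T' S S' : NTree n} {h1 h2 h3 h4} {β β' : Braid m}
    {l l' : Fin m → Braid n} (hT : T = T') (hS : S = S') (hβ : β = β') (hl : ∀ x, l x = l' x) :
    (⟨T, S, h1, h2, β, l⟩ : TreePair n m) = ⟨T', S', h3, h4, β', l'⟩ := by
  obtain rfl := funext hl
  subst hT hS hβ; rfl

theorem comp_assoc (a b c : TreePair n m) (h : a.ran = b.dom) (h' : b.ran = c.dom) :
    (a.comp b h).comp c h' = a.comp (b.comp c h') h := by
  refine ext' rfl rfl (mul_assoc _ _ _) fun x => ?_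
  simp only [comp, map_mul, Equiv.Perm.mul_apply, mul_assoc]

theorem refl_comp (a : TreePair n m) : (refl a.dom a.dom_leaves).comp a rfl = a := by
  refine ext' rfl rfl ?_ fun x => ?_
  · simp [refl]
  · simp [refl]

theorem comp_refl (a : TreePair n m) : a.comp (refl a.ran a.ran_leaves) rfl = a := by
  refine ext' rfl rfl ?_ fun x => ?_
  · simp [refl]
  · simp [refl]

theorem inv_comp (a : TreePair n m) : a.inv.comp a rfl = refl a.ran a.ran_leaves := by
  refine ext' rfl rfl ?_ fun x => ?_
  · simp [inv]
  · simp [inv]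

theorem topLeaf_ne (a : TreePair n m) {r q : Fin m} (h : q ≠ r) : a.topLeaf q ≠ a.topLeaf r :=
  fun e => h ((Braid.perm a.braid).injective (NTree.leafAt_injective _ _ e))

theorem botLeaf_ne (a : TreePair n m) {r q : Fin m} (h : q ≠ r) : a.botLeaf q ≠ a.botLeaf r :=
  fun e => h (NTree.leafAt_injective _ _ e)

theorem strands_eq {m' : ℕ} (a : TreePair n m) (b : TreePair n m') (h : a.ran = b.dom) :
    m = m' := by rw [← a.ran_leaves, ← b.dom_leaves, h]

variable [NeZero n]

theorem perm_expand_skip (a : TreePair n m) (r q : Fin m) (h : q ≠ r) :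
    Braid.perm (a.expand r).braid (Braid.skip (n - 1) r q) =
      Braid.skip (n - 1) (Braid.perm a.braid r) (Braid.perm a.braid q) := by
  simp only [expand]
  rw [map_mul, Equiv.Perm.mul_apply, Braid.perm_insert_skip _ _ _ _ h,
    Braid.perm_cable_skip _ _ _ _ h]

theorem topLeaf_expand (a : TreePair n m) (r q : Fin m) (h : q ≠ r) :
    (a.expand r).topLeaf (Braid.skip (n - 1) r q) = a.topLeaf q := by
  rw [topLeaf, perm_expand_skip a r q h]
  exact NTree.leafAt_expand _ _ _ _ (fun e => h ((Braid.perm a.braid).injective e)) _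

theorem botLeaf_expand (a : TreePair n m) (r q : Fin m) (h : q ≠ r) :
    (a.expand r).botLeaf (Braid.skip (n - 1) r q) = a.botLeaf q :=
  NTree.leafAt_expand _ _ _ _ h _

/-- Expansions along different strands commute. -/
theorem expand_expand (a : TreePair n m) (r q : Fin m) (h : q ≠ r) :
    (a.expand r).expand (Braid.skip (n - 1) r q) =
      (a.expand q).expand (Braid.skip (n - 1) q r) := by
  refine ext' ?_ ?_ ?_ fun x => ?_
  · rw [topLeaf_expand a r q h, topLeaf_expand a q r h.symm]
    exact NTree.expand_comm _ (a.topLeaf_mem r) (a.topLeaf_mem q) (a.topLeaf_ne h)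
  · rw [botLeaf_expand a r q h, botLeaf_expand a q r h.symm]
    exact NTree.expand_comm _ (a.botLeaf_mem r) (a.botLeaf_mem q) (a.botLeaf_ne h)
  · simp only [expand]
    rw [Braid.collapse_skip _ h, Braid.collapse_skip _ h.symm, Braid.cable_mul, Braid.cable_mul,
      Braid.perm_insert_skip _ _ _ _ h, Braid.perm_insert_skip _ _ _ _ h.symm,
      Braid.cable_cable _ _ _ _ h, Braid.cable_insert _ _ _ h, Braid.cable_insert _ _ _ h.symm,
      mul_assoc, mul_assoc, (Braid.insert_commute _ _ _ h _ _).eq]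
  · exact congrArg a.labels (Braid.collapse_collapse _ _ _ h x)

/-- The expansion of a composition along a strand is a composition of expansions. -/
theorem comp_expand (a b : TreePair n m) (h : a.ran = b.dom) (r : Fin m) :
    a.botLeaf (Braid.perm b.braid r) = b.topLeaf r ∧
    ∃ h' : (a.expand (Braid.perm b.braid r)).ran = (b.expand r).dom,
      (a.comp b h).expand r = (a.expand (Braid.perm b.braid r)).comp (b.expand r) h' := by
  obtain ⟨T, S, hT, hS, β, l⟩ := a
  obtain ⟨S', U, hS', hU, γ, k⟩ := b
  obtain rfl : S = S' := h
  refine ⟨rfl, rfl, ?_⟩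
  refine ext' ?_ rfl ?_ fun x => ?_
  · simp only [topLeaf, comp, map_mul, Equiv.Perm.mul_apply, expand]
  · simp only [expand, comp]
    rw [Braid.cable_mul, map_mul]
    have := (Braid.cable_semiconj_insert n γ r (l (Braid.perm γ r))).eq
    simp only [mul_assoc]
    rw [← mul_assoc (Braid.insert n _ _), ← this, mul_assoc]
  · simp only [expand, comp]
    rw [map_mul, Equiv.Perm.mul_apply, Braid.collapse_perm_cable, Braid.collapse_perm_insert]

theorem inv_expand (a : TreePair n m) (r : Fin m) :
    (a.expand r).inv = a.inv.expand (Braid.perm a.braid r) := by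
  refine ext' ?_ ?_ ?_ fun x => ?_
  · simp [expand, inv, topLeaf, botLeaf]
  · simp [expand, inv, topLeaf, botLeaf]
  · have := (Braid.cable_semiconj_insert n a.braid r (a.labels r)).eq
    have hr : Braid.perm a.braid⁻¹ (Braid.perm a.braid r) = r := by simp
    simp only [expand, inv]
    rw [Braid.cable_inv, hr, map_inv, this, mul_inv_rev]
  · obtain ⟨y, rfl⟩ := (Braid.perm (a.expand r).braid).surjective x
    have h := Braid.collapse_perm_cable (n - 1) a.braid r
      (Braid.perm (Braid.insert n r (a.labels r)) y)
    have hy : Braid.perm (a.expand r).braid⁻¹ (Braid.perm (a.expand r).braid y) = y := by simp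
    rw [Braid.collapse_perm_insert, ← Equiv.Perm.mul_apply, ← map_mul] at h
    change (a.labels (Braid.collapse (n - 1) r _))⁻¹ =
      (a.labels (Braid.perm a.braid⁻¹ (Braid.collapse (n - 1) _ _)))⁻¹
    rw [hy]
    refine congrArg (fun z => (a.labels z)⁻¹) ?_
    rw [map_inv, Equiv.Perm.eq_inv_iff_eq]
    exact h.symm

theorem refl_expand (T : NTree n) (h : T.leaves.length = m) (r : Fin m) :
    ∃ h', (refl T h).expand r = refl (T.expand (T.leafAt h r)) h' := by
  refine ⟨by rw [NTree.length_leaves_expand _ (NTree.leafAt_mem _ _ _), h],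
    ext' ?_ rfl ?_ fun x => ?_⟩
  · simp [topLeaf, refl]
  · simp [refl, Braid.cable_one]
  · rfl

/-- The braided tree pair `b` is an expansion of `a` along one strand. -/
def Step (a b : Σ m, TreePair n m) : Prop := ∃ r, b = ⟨_, a.2.expand r⟩

/-- The braided tree pair `b` is obtained from `a` by successive expansions. -/
abbrev Steps : (Σ m, TreePair n m) → (Σ m, TreePair n m) → Prop := Relation.ReflTransGen Step

theorem isInner_dom_expand (a : TreePair n m) (r : Fin m) :
    (a.expand r).dom.IsInner (a.topLeaf r) :=
  (NTree.isInner_expand _ (a.topLeaf_mem r) _).mpr (Or.inl rfl)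

theorem isInner_ran_expand (a : TreePair n m) (r : Fin m) :
    (a.expand r).ran.IsInner (a.botLeaf r) :=
  (NTree.isInner_expand _ (a.botLeaf_mem r) _).mpr (Or.inl rfl)

theorem dom_steps {a b : Σ m, TreePair n m} (h : Steps a b) :
    Relation.ReflTransGen NTree.Step a.2.dom b.2.dom := by
  refine h.lift (fun a => a.2.dom) ?_
  rintro ⟨m, a⟩ _ ⟨r, rfl⟩
  exact ⟨_, a.topLeaf_mem r, rfl⟩

theorem ran_steps {a b : Σ m, TreePair n m} (h : Steps a b) :
    Relation.ReflTransGen NTree.Step a.2.ran b.2.ran := by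
  refine h.lift (fun a => a.2.ran) ?_
  rintro ⟨m, a⟩ _ ⟨r, rfl⟩
  exact ⟨_, a.botLeaf_mem r, rfl⟩

theorem lift_dom (a : Σ m, TreePair n m) {T : NTree n}
    (h : Relation.ReflTransGen NTree.Step a.2.dom T) : ∃ b, Steps a b ∧ b.2.dom = T := by
  induction h with
  | refl => exact ⟨a, .refl, rfl⟩
  | tail _ h ih =>
    obtain ⟨⟨m, b⟩, hb, rfl⟩ := ih
    obtain ⟨w, hw, rfl⟩ := h
    obtain ⟨i, rfl⟩ := NTree.exists_leafAt _ b.dom_leaves hw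
    refine ⟨⟨_, b.expand ((Braid.perm b.braid).symm i)⟩, hb.tail ⟨_, rfl⟩, ?_⟩
    simp [expand, topLeaf]

theorem lift_ran (a : Σ m, TreePair n m) {T : NTree n}
    (h : Relation.ReflTransGen NTree.Step a.2.ran T) : ∃ b, Steps a b ∧ b.2.ran = T := by
  induction h with
  | refl => exact ⟨a, .refl, rfl⟩
  | tail _ h ih =>
    obtain ⟨⟨m, b⟩, hb, rfl⟩ := ih
    obtain ⟨w, hw, rfl⟩ := h
    obtain ⟨i, rfl⟩ := NTree.exists_leafAt _ b.ran_leaves hw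
    exact ⟨⟨_, b.expand i⟩, hb.tail ⟨_, rfl⟩, rfl⟩

theorem steps_of_dom {a b : Σ m, TreePair n m} (h : Steps a b) (r : Fin a.1)
    (hr : b.2.dom.IsInner (a.2.topLeaf r)) : Steps ⟨_, a.2.expand r⟩ b := by
  induction h using Relation.ReflTransGen.head_induction_on with
  | refl => exact absurd hr (NTree.not_isInner_of_mem _ (topLeaf_mem _ _))
  | @head a c hac hcb ih =>
    obtain ⟨m, a⟩ := a
    obtain ⟨q, rfl⟩ := hac
    dsimp only at r q hr ih hcb ⊢
    rcases eq_or_ne r q with rfl | h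
    · exact hcb
    have := ih (Braid.skip (n - 1) q r) (by rwa [topLeaf_expand a q r h])
    exact Relation.ReflTransGen.head ⟨Braid.skip (n - 1) r q, rfl⟩
      (by rwa [expand_expand a r q h.symm])

theorem steps_of_ran {a b : Σ m, TreePair n m} (h : Steps a b) (r : Fin a.1)
    (hr : b.2.ran.IsInner (a.2.botLeaf r)) : Steps ⟨_, a.2.expand r⟩ b := by
  induction h using Relation.ReflTransGen.head_induction_on with
  | refl => exact absurd hr (NTree.not_isInner_of_mem _ (botLeaf_mem _ _))
  | @head a c hac hcb ih =>
    obtain ⟨m, a⟩ := a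
    obtain ⟨q, rfl⟩ := hac
    dsimp only at r q hr ih hcb ⊢
    rcases eq_or_ne r q with rfl | h
    · exact hcb
    have := ih (Braid.skip (n - 1) q r) (by rwa [botLeaf_expand a q r h])
    exact Relation.ReflTransGen.head ⟨Braid.skip (n - 1) r q, rfl⟩
      (by rwa [expand_expand a r q h.symm])

theorem eq_of_dom {a b c : Σ m, TreePair n m} (hb : Steps a b) (hc : Steps a c)
    (h : b.2.dom = c.2.dom) : b = c := by
  induction hb using Relation.ReflTransGen.head_induction_on with
  | refl =>
    rcases hc.cases_head with rfl | ⟨d, ⟨r, rfl⟩, hd⟩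
    · rfl
    · have h1 := NTree.isInner_of_steps (dom_steps hd) (isInner_dom_expand b.2 r)
      exact absurd (h ▸ h1) (NTree.not_isInner_of_mem _ (b.2.topLeaf_mem r))
  | @head a d had hdb ih =>
    obtain ⟨r, rfl⟩ := had
    refine ih (steps_of_dom hc r ?_)
    rw [← h]
    exact NTree.isInner_of_steps (dom_steps hdb) (isInner_dom_expand a.2 r)

theorem eq_of_ran {a b c : Σ m, TreePair n m} (hb : Steps a b) (hc : Steps a c)
    (h : b.2.ran = c.2.ran) : b = c := by
  induction hb using Relation.ReflTransGen.head_induction_on with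
  | refl =>
    rcases hc.cases_head with rfl | ⟨d, ⟨r, rfl⟩, hd⟩
    · rfl
    · have h1 := NTree.isInner_of_steps (ran_steps hd) (isInner_ran_expand b.2 r)
      exact absurd (h ▸ h1) (NTree.not_isInner_of_mem _ (b.2.botLeaf_mem r))
  | @head a d had hdb ih =>
    obtain ⟨r, rfl⟩ := had
    refine ih (steps_of_ran hc r ?_)
    rw [← h]
    exact NTree.isInner_of_steps (ran_steps hdb) (isInner_ran_expand a.2 r)

theorem comp_steps {a b : TreePair n m} {m' : ℕ} {a' b' : TreePair n m'}
    (ha : Steps ⟨m, a⟩ ⟨m', a'⟩) (hb : Steps ⟨m, b⟩ ⟨m', b'⟩) (h : a.ran = b.dom)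
    (h' : a'.ran = b'.dom) : Steps ⟨m, a.comp b h⟩ ⟨m', a'.comp b' h'⟩ := by
  generalize hx : (⟨m, a⟩ : Σ m, TreePair n m) = x at ha
  generalize hy : (⟨m', a'⟩ : Σ m, TreePair n m) = y at ha
  induction ha using Relation.ReflTransGen.head_induction_on generalizing m a b with
  | refl =>
    obtain ⟨rfl, hxy⟩ := Sigma.mk.inj (hx.trans hy.symm)
    obtain rfl := eq_of_heq hxy
    have := eq_of_dom hb .refl (h'.symm.trans h)
    obtain rfl := eq_of_heq (Sigma.mk.inj this).2
    exact .refl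
  | @head c d hcd hd ih =>
    subst hx hy
    obtain ⟨q, rfl⟩ := hcd
    dsimp only at q hd
    obtain ⟨r, rfl⟩ := (Braid.perm b.braid).surjective q
    obtain ⟨e, h1, h2⟩ := comp_expand a b h r
    refine Relation.ReflTransGen.head (b := ⟨_, (a.comp b h).expand r⟩) ⟨r, rfl⟩ ?_
    rw [h2]
    refine ih (steps_of_dom hb r ?_) h1 rfl
    change b'.dom.IsInner (b.topLeaf r)
    rw [← e, ← h']
    exact NTree.isInner_of_steps (ran_steps hd) (isInner_ran_expand a _)

theorem refl_steps {T S : NTree n} (h : Relation.ReflTransGen NTree.Step T S) :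
    Steps ⟨_, refl T rfl⟩ ⟨_, refl S rfl⟩ := by
  refine h.lift (fun T => (⟨_, refl T rfl⟩ : Σ m, TreePair n m)) ?_
  rintro T _ ⟨w, hw, rfl⟩
  obtain ⟨i, rfl⟩ := NTree.exists_leafAt _ (rfl : T.leaves.length = _) hw
  refine ⟨i, ?_⟩
  obtain ⟨h', e⟩ := refl_expand T rfl i
  have gen : ∀ (m : ℕ) (U : NTree n) (h : U.leaves.length = m),
      (⟨_, refl U rfl⟩ : Σ m, TreePair n m) = ⟨m, refl U h⟩ := by rintro m U rfl; rfl
  exact (gen _ _ h').trans (by rw [← e])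

/-- Any two braided tree pairs have expansions that can be composed. -/
theorem exists_composable (a b : Σ m, TreePair n m) :
    ∃ p : Σ m, { p : TreePair n m × TreePair n m // p.1.ran = p.2.dom },
      Steps a ⟨p.1, p.2.1.1⟩ ∧ Steps b ⟨p.1, p.2.1.2⟩ := by
  obtain ⟨U, h1, h2⟩ := NTree.exists_common a.2.ran b.2.dom
  obtain ⟨⟨m, a'⟩, ha, rfl⟩ := lift_ran a h1
  obtain ⟨⟨m', b'⟩, hb, hb'⟩ := lift_dom b h2
  obtain rfl := strands_eq a' b' hb'.symm
  exact ⟨⟨m, ⟨(a', b'), hb'.symm⟩⟩, ha, hb⟩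

end TreePair

/-- The set underlying the group `BV_n(B_n)`: braided tree pairs `(T, β, λ, T')` with labels in the
braid group on `n` strands, up to the equivalence relation generated by expansions. -/
def BV (n : ℕ) [NeZero n] : Type := Quot (TreePair.Step (n := n))

namespace BV

variable {n : ℕ} [NeZero n]

/-- The element of `BV_n(B_n)` represented by a braided tree pair. -/
def mk {m : ℕ} (a : TreePair n m) : BV n := Quot.mk _ ⟨m, a⟩

theorem mk_eq_of_steps {m m' : ℕ} {a : TreePair n m} {b : TreePair n m'}
    (h : TreePair.Steps ⟨m, a⟩ ⟨m', b⟩) : mk a = mk b := by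
  have : ∀ x y : Σ m, TreePair n m, TreePair.Steps x y → mk x.2 = mk y.2 := by
    intro x y h
    induction h with
    | refl => rfl
    | tail _ h ih => exact ih.trans (Quot.sound h)
  exact this _ _ h

/-- The class of a composition of expansions of `a` and `b` does not depend on the expansions. -/
theorem mk_comp_eq {a b : Σ m, TreePair n m} {m' k : ℕ} {a' b' : TreePair n m'}
    {c d : TreePair n k} (ha : TreePair.Steps a ⟨m', a'⟩) (hb : TreePair.Steps b ⟨m', b'⟩)
    (h : a'.ran = b'.dom) (hc : TreePair.Steps a ⟨k, c⟩) (hd : TreePair.Steps b ⟨k, d⟩)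
    (e : c.ran = d.dom) : mk (c.comp d e) = mk (a'.comp b' h) := by
  obtain ⟨U, h1, h2⟩ := NTree.exists_common a'.ran c.ran
  obtain ⟨⟨m1, a1⟩, ha1, ha1'⟩ := TreePair.lift_ran ⟨m', a'⟩ h1
  obtain ⟨⟨m2, c1⟩, hc1, hc1'⟩ := TreePair.lift_ran ⟨k, c⟩ h2
  obtain ⟨⟨m3, b1⟩, hb1, hb1'⟩ := TreePair.lift_dom ⟨m', b'⟩ (h ▸ h1)
  obtain ⟨⟨m4, d1⟩, hd1, hd1'⟩ := TreePair.lift_dom ⟨k, d⟩ (e ▸ h2)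
  dsimp only at ha1' hc1' hb1' hd1'
  obtain rfl := TreePair.strands_eq a1 b1 (ha1'.trans hb1'.symm)
  obtain rfl := TreePair.strands_eq c1 d1 (hc1'.trans hd1'.symm)
  obtain ⟨rfl, h3⟩ := Sigma.mk.inj
    (TreePair.eq_of_ran (ha.trans ha1) (hc.trans hc1) (ha1'.trans hc1'.symm))
  obtain rfl := eq_of_heq h3
  obtain rfl := eq_of_heq (Sigma.mk.inj
    (TreePair.eq_of_dom (hb.trans hb1) (hd.trans hd1) (hb1'.trans hd1'.symm))).2
  rw [mk_eq_of_steps (TreePair.comp_steps hc1 hd1 e (ha1'.trans hb1'.symm)),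
    mk_eq_of_steps (TreePair.comp_steps ha1 hb1 h (ha1'.trans hb1'.symm))]

/-- The product of the elements represented by `a` and `b`: the class of the composition of
some expansions of `a` and `b` that can be composed. -/
noncomputable def mulAux (a b : Σ m, TreePair n m) : BV n :=
  let p := (TreePair.exists_composable a b).choose
  mk (p.2.1.1.comp p.2.1.2 p.2.2)

theorem mulAux_eq {a b : Σ m, TreePair n m} {m' : ℕ} {a' b' : TreePair n m'}
    (ha : TreePair.Steps a ⟨m', a'⟩) (hb : TreePair.Steps b ⟨m', b'⟩) (h : a'.ran = b'.dom) :
    mulAux a b = mk (a'.comp b' h) :=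
  mk_comp_eq ha hb h (TreePair.exists_composable a b).choose_spec.1
    (TreePair.exists_composable a b).choose_spec.2 _

theorem mulAux_step_left {a a' : Σ m, TreePair n m} (b) (h : TreePair.Step a a') :
    mulAux a b = mulAux a' b := by
  obtain ⟨⟨k, ⟨⟨c, d⟩, e⟩⟩, hc, hd⟩ := TreePair.exists_composable a' b
  rw [mulAux_eq hc hd e, mulAux_eq (hc.head h) hd e]

theorem mulAux_step_right (a) {b b' : Σ m, TreePair n m} (h : TreePair.Step b b') :
    mulAux a b = mulAux a b' := by
  obtain ⟨⟨k, ⟨⟨c, d⟩, e⟩⟩, hc, hd⟩ := TreePair.exists_composable a b'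
  rw [mulAux_eq hc hd e, mulAux_eq hc (hd.head h) e]

noncomputable instance : Mul (BV n) where
  mul := Quot.lift (fun a => Quot.lift (fun b => mulAux a b) fun _ _ => mulAux_step_right a)
    fun _ _ h => funext fun b => Quot.inductionOn b fun b => mulAux_step_left b h

instance : One (BV n) where
  one := mk (TreePair.refl NTree.leaf rfl)

instance : Inv (BV n) where
  inv := Quot.lift (fun a => mk a.2.inv) (by
    rintro ⟨m, a⟩ _ ⟨r, rfl⟩
    exact (mk_eq_of_steps (.single ⟨Braid.perm a.braid r, rfl⟩)).trans
      (congrArg mk (TreePair.inv_expand a r).symm))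

instance : Inhabited (BV n) := ⟨1⟩

/-- `(T, β, λ, T') (T', β', λ', T'') = (T, ββ', λλ', T'')`. -/
theorem mk_mul_mk {m : ℕ} (a b : TreePair n m) (h : a.ran = b.dom) :
    mk a * mk b = mk (a.comp b h) :=
  mulAux_eq .refl .refl h

theorem mk_refl {m : ℕ} (T : NTree n) (h : T.leaves.length = m) : mk (TreePair.refl T h) = 1 := by
  subst h
  exact (mk_eq_of_steps (TreePair.refl_steps (NTree.steps_from_leaf T))).symm

theorem exists_rep (x : BV n) : ∃ (m : ℕ) (a : TreePair n m), x = mk a := by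
  obtain ⟨⟨m, a⟩, rfl⟩ := Quot.exists_rep x
  exact ⟨m, a, rfl⟩

theorem exists_rep₂ (x y : BV n) : ∃ (m : ℕ) (a b : TreePair n m) (_ : a.ran = b.dom),
    x = mk a ∧ y = mk b := by
  obtain ⟨k, a, rfl⟩ := exists_rep x
  obtain ⟨l, b, rfl⟩ := exists_rep y
  obtain ⟨⟨m, ⟨⟨c, d⟩, e⟩⟩, hc, hd⟩ := TreePair.exists_composable ⟨k, a⟩ ⟨l, b⟩
  exact ⟨m, c, d, e, mk_eq_of_steps hc, mk_eq_of_steps hd⟩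

noncomputable instance : Group (BV n) :=
  Group.ofLeftAxioms
    (by
      intro x y z
      obtain ⟨m, a, b, h, rfl, rfl⟩ := exists_rep₂ x y
      obtain ⟨l, c, rfl⟩ := exists_rep z
      obtain ⟨⟨k, ⟨⟨b', c'⟩, e⟩⟩, hb, hc⟩ := TreePair.exists_composable ⟨m, b⟩ ⟨l, c⟩
      dsimp only at hb hc e
      obtain ⟨⟨k', a'⟩, ha, ha'⟩ := TreePair.lift_ran ⟨m, a⟩ (h ▸ TreePair.dom_steps hb)
      dsimp only at ha'
      obtain rfl := TreePair.strands_eq a' b' ha'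
      rw [mk_eq_of_steps ha, mk_eq_of_steps hb, mk_eq_of_steps hc, mk_mul_mk _ _ ha',
        mk_mul_mk _ _ e, mk_mul_mk _ _ (show (a'.comp b' ha').ran = c'.dom from e),
        mk_mul_mk _ _ (show a'.ran = (b'.comp c' e).dom from ha'), TreePair.comp_assoc])
    (by
      intro x
      obtain ⟨m, a, rfl⟩ := exists_rep x
      rw [← mk_refl a.dom a.dom_leaves, mk_mul_mk (TreePair.refl a.dom a.dom_leaves) a rfl,
        TreePair.refl_comp])
    (by
      intro x
      obtain ⟨m, a, rfl⟩ := exists_rep x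
      exact (mk_mul_mk a.inv a rfl).trans
        ((congrArg mk a.inv_comp).trans (mk_refl _ a.ran_leaves)))

end BV

section Generators

variable (n : ℕ)

/-- The `n`-ary tree `R` with exactly one caret; its leaves are the words of length one. -/
def treeR : NTree n := NTree.leaf.expand []

variable {n} in
theorem mem_treeR (i : Fin n) : [i] ∈ (treeR n).leaves := by
  simp [treeR, NTree.expand, NTree.leaves]

theorem length_treeR : (treeR n).leaves.length = n := by
  simp [treeR, NTree.expand, NTree.leaves]

variable [n.AtLeastTwo]

variable {n} in
theorem length_treeR_expand (i : Fin n) :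
    ((treeR n).expand [i]).leaves.length = n + (n - 1) := by
  rw [NTree.length_leaves_expand _ (mem_treeR i), length_treeR]

/-- The last letter `n - 1` of the alphabet `{0, …, n - 1}`. -/
def lastLetter : Fin n := ⟨n - 1, Nat.sub_lt (NeZero.pos n) one_pos⟩

variable {n} in
theorem length_treeR_expand_expand (i : Fin n) :
    (((treeR n).expand [lastLetter n]).expand [lastLetter n, i]).leaves.length =
      n + (n - 1) + (n - 1) := by
  rw [NTree.length_leaves_expand, length_treeR_expand]
  simp [treeR, NTree.expand, NTree.leaves]

variable {n} in
/-- The element `(T, Id, Id, T')`. -/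
def ofTrees {m : ℕ} (T T' : NTree n) (h : T.leaves.length = m) (h' : T'.leaves.length = m) :
    BV n :=
  BV.mk ⟨T, T', h, h', 1, fun _ => 1⟩

/-- The `n` standard generators of `F_n`: `(R[n-1], Id, Id, R[i])` for `0 ≤ i ≤ n - 2`, and
`(R[n-1][(n-1)(n-1)], Id, Id, R[n-1][(n-1)0])` for `i = n - 1`. -/
def genTree (i : Fin n) : BV n :=
  if i.val < n - 1 then
    ofTrees ((treeR n).expand [lastLetter n]) ((treeR n).expand [i])
      (length_treeR_expand _) (length_treeR_expand _)
  else
    ofTrees (((treeR n).expand [lastLetter n]).expand [lastLetter n, lastLetter n])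
      (((treeR n).expand [lastLetter n]).expand [lastLetter n, 0])
      (length_treeR_expand_expand _) (length_treeR_expand_expand _)

/-- The tree `R' = R[1]` if `n = 2`, and `R' = R[2]` if `n ≥ 3`. -/
def treeR' : NTree n :=
  (treeR n).expand [⟨if n = 2 then 1 else 2, by
    have := Nat.AtLeastTwo.prop (n := n)
    split_ifs <;> omega⟩]

/-- The element `(R', σ, Id, R')`, where `σ` is the last of the `2 n - 2` Artin generators of the
braid group on `2 n - 1` strands: `σ_{2n-2}` when these are numbered from `1`, and so the one with
index `2 n - 3` when they are numbered from `0`. -/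
def genBraid : BV n :=
  BV.mk (m := n + (n - 1)) ⟨treeR' n, treeR' n, length_treeR_expand _, length_treeR_expand _,
    Braid.σ (n + (n - 1)) (2 * n - 3), fun _ => 1⟩

/-- The element `(R, Id, {σ, Id, …, Id}, R)`, where `σ` is the `j`-th Artin generator of the braid
group on `n` strands, `1 ≤ j ≤ n - 1` (here `j` is numbered from `0`). -/
def genLabel (j : Fin (n - 1)) : BV n :=
  BV.mk (m := n) ⟨treeR n, treeR n, length_treeR n, length_treeR n, 1,
    fun r => if r.val = 0 then Braid.σ n j else 1⟩

end Generators

/-!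
Let `H` be a subgroup that contains the `2 n` elements.

*Trees.* Write `C k` for the right comb with `k` carets and `x i` for the element that moves a caret
from the last leaf of a comb to its `i`-th leaf (`BV.combGen`); it does not depend on the size of
the comb. The given elements are `x 0, …, x (n - 1)`, and `x (i + n - 1) = x 0 * x i * (x 0)⁻¹` for
`i ≥ 1` yields the others. Adding carets to a tree `T` one after the other writes
`(C k, Id, Id, T)` as a product of the `x i`, so `H` contains all `(T, Id, Id, T')`
(`BV.ofTrees_mem`).

*Labels.* By conjugation with these, whether `H` contains all labels at the `i`-th leaf of a tree
with `m` leaves depends only on `m` and `i` (`BV.LabelsAt`). Expanding along another strand relates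
`(m, i)` to `(m + n - 1, i)` if that strand is on the right of `i`, and to
`(m + n - 1, i + n - 1)` if it is on the left. Expanding along the labelled strand itself shows the
label `σ a` at a leaf as an element that braids the children of this leaf, so conjugation by it
moves labels from one child to the next. From the labels at the first leaf of `R` this reaches
all leaves but the last one, and the generator `(R', σ, Id, R')` carries labels to the last leaf
(`BV.labelsAt_all`).

*Braids.* The label `σ a` at the `i`-th leaf is the product of the unlabelled braid `σ (i + a)` on
the expanded tree and of labels in `H`. All generators of the braid group on at least `2 n - 1`
strands arise in this way (`BV.braidHom_mem`), and every element has a representative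
`(T, β, λ, T') = (T, β, Id, T) (T, Id, Id, T') (T', Id, λ, T')` with that many strands.

*Distinctness.* A braided tree pair acts on words by replacing the prefix that is a leaf of the
range tree and permuting the letters of the rest (`TreePair.Maps`). An expansion restricts this
action to longer words, and equivalent pairs have a common expansion, so they act alike on all long words
(`BV.HasStrand.append_eq_append`). Words `(n - 1)(n - 1)⋯` separate the three kinds of generators,
words `i 0 0 ⋯` the generators of `F_n`, and words `0 j j ⋯` the labels.
-/

/-! ### Combs, and the generators of `F_n` -/

namespace NTree

variable {n : ℕ}

/-- The `i`-th leaf of a tree is replaced by its `n` children, in order. -/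
theorem leafAt_expand_blk (T : NTree n) {m : ℕ} (h : T.leaves.length = m) (i : Fin m) (a : Fin n)
    (h' : (T.expand (T.leafAt h i)).leaves.length = m + (n - 1)) (x : Fin (m + (n - 1)))
    (hx : x.val = i + a) : (T.expand (T.leafAt h i)).leafAt h' x = T.leafAt h i ++ [a] := by
  obtain ⟨A, B, h1, h2⟩ := T.leaves_expand (T.leafAt_mem h i)
  have hA : A.length = i := by
    have hA' : A.length < T.leaves.length := by rw [h1]; simp
    refine (T.nodup_leaves.getElem_inj_iff (hi := hA') (hj := by omega)).mp ?_
    have : T.leaves[A.length] = T.leafAt h i := by simp [h1]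
    rw [this]; rfl
  have ha := a.isLt
  unfold leafAt at h2 ⊢
  simp only [h2]
  rw [List.getElem_append_left (by simp; omega), List.getElem_append_right (by omega)]
  simp only [List.getElem_map, List.getElem_finRange]
  congr 2
  ext
  simp
  omega

variable [NeZero n]

/-- The `j`-th leaf is still a leaf after the `i`-th one is expanded, `j ≠ i`; its position `x` has
moved by `n - 1` if it is on the right of the `i`-th leaf. -/
theorem leafAt_expand_of_val (T : NTree n) {m : ℕ} (h : T.leaves.length = m) (i j : Fin m)
    (hij : j ≠ i) (h' : (T.expand (T.leafAt h i)).leaves.length = m + (n - 1))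
    (x : Fin (m + (n - 1))) (hx : x.val = if j.val < i then j.val else j + (n - 1)) :
    (T.expand (T.leafAt h i)).leafAt h' x = T.leafAt h j := by
  rw [← leafAt_expand T h i j hij h']
  congr 1
  exact Fin.ext hx

theorem length_expand_leafAt (T : NTree n) {m : ℕ} (h : T.leaves.length = m) (i : Fin m) :
    (T.expand (T.leafAt h i)).leaves.length = m + (n - 1) := by
  rw [length_leaves_expand _ (T.leafAt_mem h i), h]

theorem exists_length_leaves (T : NTree n) : ∃ k, T.leaves.length = 1 + k * (n - 1) := by
  induction steps_from_leaf T with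
  | refl => exact ⟨0, by simp [leaves]⟩
  | tail _ hs ih =>
    obtain ⟨k, hk⟩ := ih
    obtain ⟨w, hw, rfl⟩ := hs
    exact ⟨k + 1, by rw [length_leaves_expand _ hw, hk]; ring⟩

theorem length_pos (T : NTree n) {m : ℕ} (h : T.leaves.length = m) : 0 < m := by
  obtain ⟨k, hk⟩ := T.exists_length_leaves
  omega

/-- The vertex at the end of the rightmost path of length `k`. -/
def rightWord (n : ℕ) [n.AtLeastTwo] (k : ℕ) : List (Fin n) := List.replicate k (lastLetter n)

/-- The right comb with `k` carets, each of them appended to the last leaf. -/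
def comb (n : ℕ) [n.AtLeastTwo] : ℕ → NTree n
  | 0 => leaf
  | k + 1 => (comb n k).expand (rightWord n k)

section comb

variable {n : ℕ} [n.AtLeastTwo]

theorem comb_length_and_last (k : ℕ) : ∃ h : (comb n k).leaves.length = 1 + k * (n - 1),
    ∀ i : Fin (1 + k * (n - 1)), i.val = k * (n - 1) → (comb n k).leafAt h i = rightWord n k := by
  induction k with
  | zero => exact ⟨by simp [comb, leaves], fun i _ => by simp [leafAt, comb, leaves, rightWord]⟩
  | succ k ih =>
    obtain ⟨h, hl⟩ := ih
    have hl' := hl ⟨k * (n - 1), by omega⟩ rfl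
    have e : 1 + (k + 1) * (n - 1) = 1 + k * (n - 1) + (n - 1) := by ring
    have hlen : (comb n (k + 1)).leaves.length = 1 + k * (n - 1) + (n - 1) := by
      rw [comb, ← hl', length_expand_leafAt]
    refine ⟨hlen.trans e.symm, ?_⟩
    intro i hi
    have h2 : ((comb n k).expand ((comb n k).leafAt h ⟨k * (n - 1), by omega⟩)).leaves.length =
      1 + k * (n - 1) + (n - 1) := length_expand_leafAt _ _ _
    have := leafAt_expand_blk (comb n k) h ⟨k * (n - 1), by omega⟩ (lastLetter n) h2
      ⟨i, by omega⟩ (by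
        simp [hi, lastLetter]; ring)
    simp only [hl'] at this
    rw [rightWord, List.replicate_succ']
    exact this

theorem length_comb (k : ℕ) : (comb n k).leaves.length = 1 + k * (n - 1) :=
  (comb_length_and_last k).1

theorem leafAt_comb_last (k : ℕ) (i : Fin (1 + k * (n - 1))) (hi : i.val = k * (n - 1)) :
    (comb n k).leafAt (length_comb k) i = rightWord n k := (comb_length_and_last k).2 i hi

theorem length_comb_succ (k : ℕ) : (comb n (k + 1)).leaves.length = 1 + k * (n - 1) + (n - 1) := by
  rw [length_comb]; ring

theorem leafAt_comb_succ_last (k : ℕ) (i : Fin (1 + k * (n - 1) + (n - 1)))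
    (hi : i.val = k * (n - 1) + (n - 1)) :
    (comb n (k + 1)).leafAt (length_comb_succ k) i = rightWord n (k + 1) := by
  have e : 1 + (k + 1) * (n - 1) = 1 + k * (n - 1) + (n - 1) := by ring
  exact leafAt_comb_last (k + 1) ⟨i, by omega⟩ (by simp only [hi]; ring)

/-- The leaves of a comb other than the last one stay in place when the comb grows. -/
theorem leafAt_comb_succ (k : ℕ) (i : Fin (1 + k * (n - 1))) (hi : i.val < k * (n - 1))
    (x : Fin (1 + k * (n - 1) + (n - 1))) (hx : x.val = i) :
    (comb n (k + 1)).leafAt (length_comb_succ k) x = (comb n k).leafAt (length_comb k) i := by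
  have hl := leafAt_comb_last (n := n) k ⟨k * (n - 1), by omega⟩ rfl
  have := leafAt_expand_of_val (comb n k) (length_comb k) ⟨k * (n - 1), by omega⟩ i
    (by simp [Fin.ext_iff]; omega) (length_expand_leafAt _ _ _) x (by simp [hx, hi])
  simp only [hl] at this
  exact this

theorem leafAt_treeR (i : Fin n) : (treeR n).leafAt (length_treeR n) i = [i] := by
  have h : (leaf : NTree n).leaves.length = 1 := rfl
  have hn := NeZero.pos n
  have e : 1 + (n - 1) = n := by omega
  have := leafAt_expand_blk (leaf : NTree n) h 0 i (length_expand_leafAt _ _ _)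
    ⟨i, by omega⟩ (by simp)
  exact this

end comb

end NTree

namespace BV

variable {n : ℕ}

theorem mk_expand [NeZero n] {m : ℕ} (a : TreePair n m) (r : Fin m) : mk a = mk (a.expand r) :=
  Quot.sound ⟨r, rfl⟩

variable [n.AtLeastTwo]

theorem ofTrees_expand {m : ℕ} {T T' : NTree n} (h : T.leaves.length = m)
    (h' : T'.leaves.length = m) (i : Fin m) :
    ofTrees T T' h h' = ofTrees (T.expand (T.leafAt h i)) (T'.expand (T'.leafAt h' i))
      (NTree.length_expand_leafAt _ _ _) (NTree.length_expand_leafAt _ _ _) := by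
  refine (mk_expand _ i).trans (congrArg mk (TreePair.ext' ?_ rfl ?_ fun x => rfl))
  · simp [TreePair.topLeaf]
  · simp [Braid.cable_one]

theorem ofTrees_mul {m : ℕ} {T T' T'' : NTree n} (h : T.leaves.length = m)
    (h' : T'.leaves.length = m) (h'' : T''.leaves.length = m) :
    ofTrees T T' h h' * ofTrees T' T'' h' h'' = ofTrees T T'' h h'' := by
  refine (mk_mul_mk _ _ rfl).trans (congrArg mk (TreePair.ext' rfl rfl ?_ fun x => ?_)) <;> simp

theorem ofTrees_self {m : ℕ} {T : NTree n} (h h' : T.leaves.length = m) :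
    ofTrees T T h h' = 1 := mk_refl T h

theorem ofTrees_inv {m : ℕ} {T T' : NTree n} (h : T.leaves.length = m)
    (h' : T'.leaves.length = m) : (ofTrees T T' h h')⁻¹ = ofTrees T' T h' h := by
  rw [inv_eq_iff_mul_eq_one, ofTrees_mul, ofTrees_self]

theorem ofTrees_congr {m m' : ℕ} {T T' S S' : NTree n} {h : T.leaves.length = m}
    {h' : T'.leaves.length = m} {k : S.leaves.length = m'} {k' : S'.leaves.length = m'}
    (e : T = S) (e' : T' = S') : ofTrees T T' h h' = ofTrees S S' k k' := by
  subst e e'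
  obtain rfl : m = m' := h.symm.trans k
  rfl

/-- The element `x_i` of the infinite standard generating set of `F_n`: a caret at the last leaf
of the right comb with `k` carets is moved to its `i`-th leaf. -/
def combGen (k : ℕ) (i : Fin (1 + k * (n - 1))) : BV n :=
  ofTrees (NTree.comb n (k + 1))
    ((NTree.comb n k).expand ((NTree.comb n k).leafAt (NTree.length_comb k) i))
    (NTree.length_comb_succ k) (NTree.length_expand_leafAt _ _ _)

theorem combGen_last (k : ℕ) (i : Fin (1 + k * (n - 1))) (hi : i.val = k * (n - 1)) :
    combGen k i = (1 : BV n) := by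
  have : (NTree.comb n k).expand ((NTree.comb n k).leafAt (NTree.length_comb k) i) =
      NTree.comb n (k + 1) := by rw [NTree.leafAt_comb_last k i hi, NTree.comb]
  exact (ofTrees_congr (k := NTree.length_comb_succ k) (k' := NTree.length_comb_succ k)
    rfl this).trans (ofTrees_self _ _)

/-- The element `x_i` does not depend on the size of the comb, as long as `i` is not the last
leaf. -/
theorem combGen_succ (k : ℕ) (i : Fin (1 + k * (n - 1))) (hi : i.val < k * (n - 1))
    (x : Fin (1 + (k + 1) * (n - 1))) (hx : x.val = i) :
    combGen (k + 1) x = (combGen k i : BV n) := by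
  have e : 1 + (k + 1) * (n - 1) = 1 + k * (n - 1) + (n - 1) := by ring
  have hn := NeZero.pos n
  rw [combGen, combGen, ofTrees_expand (NTree.length_comb_succ k) _
    ⟨k * (n - 1) + (n - 1), by omega⟩]
  refine ofTrees_congr ?_ ?_
  · rw [NTree.leafAt_comb_succ_last k _ rfl]; rfl
  · have h1 : (NTree.comb n (k + 1)).leafAt (NTree.length_comb (k + 1)) x =
        (NTree.comb n k).leafAt (NTree.length_comb k) i :=
      NTree.leafAt_comb_succ k i hi ⟨x, by omega⟩ hx
    have hl := NTree.leafAt_comb_last (n := n) k ⟨k * (n - 1), by omega⟩ rfl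
    have hne : (⟨k * (n - 1), by omega⟩ : Fin (1 + k * (n - 1))) ≠ i := by
      simp [Fin.ext_iff]; omega
    rw [NTree.leafAt_expand_of_val _ (NTree.length_comb k) i ⟨k * (n - 1), by omega⟩ hne _ _
      (by simp; omega), h1, hl]
    rw [NTree.comb, ← hl]
    exact NTree.expand_comm _ (NTree.leafAt_mem _ _ _) (NTree.leafAt_mem _ _ _)
      (fun e => hne (NTree.leafAt_injective _ _ e).symm)

/-- The relation `x_{i + n - 1} x_0 = x_0 x_i` for `i ≥ 1`. -/
theorem combGen_mul_combGen (k : ℕ) (hk : 0 < k) (i : Fin (1 + k * (n - 1))) (hi : 0 < i.val)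
    (x : Fin (1 + (k + 1) * (n - 1))) (hx : x.val = i + (n - 1)) :
    (combGen (k + 1) x : BV n) * combGen k ⟨0, by omega⟩ =
      combGen (k + 1) ⟨0, by omega⟩ * combGen k i := by
  have e : 1 + (k + 1) * (n - 1) = 1 + k * (n - 1) + (n - 1) := by ring
  have hn := Nat.AtLeastTwo.prop (n := n)
  have hkn : 0 < k * (n - 1) := Nat.mul_pos hk (by omega)
  have hne : i ≠ ⟨0, by omega⟩ := fun h => hi.ne' (congrArg Fin.val h)
  have h0 := NTree.length_comb (n := n) k
  rw [combGen, combGen, combGen, combGen,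
    ofTrees_expand (NTree.length_comb_succ k)
      (NTree.length_expand_leafAt (NTree.comb n k) h0 ⟨0, by omega⟩) ⟨x, by omega⟩,
    ofTrees_expand (NTree.length_comb_succ k)
      (NTree.length_expand_leafAt (NTree.comb n k) h0 i) ⟨0, by omega⟩]
  have w1 := NTree.leafAt_expand_of_val (NTree.comb n k) h0 ⟨0, by omega⟩ i hne
    (NTree.length_expand_leafAt _ _ _) ⟨x, by omega⟩ (by rw [if_neg (by simp)]; exact hx)
  have w2 := NTree.leafAt_expand_of_val (NTree.comb n k) h0 i ⟨0, by omega⟩ hne.symm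
    (NTree.length_expand_leafAt _ _ _) ⟨0, by omega⟩ (by rw [if_pos (by exact hi)])
  have comm := NTree.expand_comm (NTree.comb n k) (NTree.leafAt_mem _ h0 ⟨0, by omega⟩)
    (NTree.leafAt_mem _ h0 i) (fun e => hne (NTree.leafAt_injective _ _ e))
  have l1 := NTree.length_expand_leafAt (NTree.comb n (k + 1)) (NTree.length_comb_succ k)
    ⟨x, by omega⟩
  have l2 := NTree.length_expand_leafAt (NTree.comb n (k + 1)) (NTree.length_comb_succ k)
    ⟨0, by omega⟩
  have l3 := NTree.length_expand_leafAt _ (NTree.length_expand_leafAt (NTree.comb n k) h0 i)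
    ⟨0, by omega⟩
  have l4 : (NTree.comb n (k + 2)).leaves.length = 1 + k * (n - 1) + (n - 1) + (n - 1) := by
    rw [NTree.length_comb]; ring
  refine Eq.trans ?_ (Eq.trans (ofTrees_mul l4 l1 l3) ((ofTrees_mul l4 l2 l3).symm.trans ?_))
  · refine congrArg₂ _ (ofTrees_congr rfl rfl) (ofTrees_congr rfl ?_)
    rw [w1, w2, comm]
  · refine congrArg₂ _ (ofTrees_congr rfl ?_) rfl
    rfl

variable {H : Subgroup (BV n)}

theorem combGen_mem (hH : ∀ i, genTree n i ∈ H) (k : ℕ) (hk : 1 ≤ k) :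
    ∀ i : Fin (1 + k * (n - 1)), combGen k i ∈ H := by
  have hn := Nat.AtLeastTwo.prop (n := n)
  induction k, hk using Nat.le_induction with
  | base =>
    intro i
    rcases eq_or_ne i.val (n - 1) with hi | hi
    · rw [combGen_last 1 i (by omega)]; exact H.one_mem
    · have := hH ⟨i, by omega⟩
      rw [genTree, if_pos (by simp; omega)] at this
      convert this using 1
      refine ofTrees_congr rfl ?_
      have h1 := NTree.leafAt_treeR (n := n) ⟨i, by omega⟩
      rw [← h1]; rfl
  | succ k hk ih =>
    intro x
    have e : 1 + (k + 1) * (n - 1) = 1 + k * (n - 1) + (n - 1) := by ring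
    have hkn : n - 1 ≤ k * (n - 1) := Nat.le_mul_of_pos_left _ hk
    have small : ∀ x : Fin (1 + (k + 1) * (n - 1)), x.val < k * (n - 1) →
        combGen (k + 1) x ∈ H := by
      intro x hx
      rw [combGen_succ k ⟨x, by omega⟩ hx x rfl]
      exact ih _
    rcases lt_or_ge x.val (k * (n - 1)) with hx | hx
    · exact small x hx
    rcases eq_or_ne x.val (n - 1) with hx' | hx'
    · -- here `k = 1`, and the element is the last of the `n` standard generators
      have hk1 : k = 1 := by
        by_contra hk1
        have : 2 * (n - 1) ≤ k * (n - 1) := Nat.mul_le_mul_right _ (by omega)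
        omega
      subst hk1
      have := hH (lastLetter n)
      rw [genTree, if_neg (by simp [lastLetter])] at this
      convert this using 1
      refine ofTrees_congr rfl ?_
      change (NTree.comb n 2).expand _ = (NTree.comb n 2).expand _
      congr 1
      have h2 := NTree.leafAt_expand_blk (treeR n) (length_treeR n) (lastLetter n) 0
        (NTree.length_expand_leafAt _ _ _) ⟨x, by omega⟩ (by simpa [lastLetter] using hx')
      simp only [NTree.leafAt_treeR] at h2
      exact h2
    · have := combGen_mul_combGen k hk ⟨x - (n - 1), by omega⟩ (by simp; omega) x
        (by simp; omega)
      rw [← eq_mul_inv_iff_mul_eq] at this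
      rw [this]
      exact H.mul_mem (H.mul_mem (small _ (by simp; omega)) (ih _)) (H.inv_mem (ih _))

theorem ofTrees_comb_mem (hH : ∀ i, genTree n i ∈ H) (T : NTree n) :
    ∃ k, ∃ h, ofTrees (NTree.comb n k) T (NTree.length_comb k) h ∈ H := by
  induction NTree.steps_from_leaf T with
  | refl =>
    refine ⟨0, NTree.length_comb (n := n) 0, ?_⟩
    have : ofTrees (NTree.comb n 0) NTree.leaf (NTree.length_comb 0) (NTree.length_comb 0) = 1 :=
      ofTrees_self _ _
    rw [this]
    exact H.one_mem
  | tail _ hs ih =>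
    obtain ⟨k, h, hk⟩ := ih
    obtain ⟨w, hw, rfl⟩ := hs
    obtain ⟨i, rfl⟩ := NTree.exists_leafAt _ h hw
    have e : 1 + (k + 1) * (n - 1) = 1 + k * (n - 1) + (n - 1) := by ring
    refine ⟨k + 1, by rw [NTree.length_expand_leafAt, e], ?_⟩
    have hx : combGen k i ∈ H := by
      rcases Nat.eq_zero_or_pos k with rfl | hk
      · rw [combGen_last 0 i (by omega)]; exact H.one_mem
      · exact combGen_mem hH k hk i
    rw [ofTrees_expand _ _ i] at hk
    have := H.mul_mem hx hk
    rw [combGen, ofTrees_mul] at this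
    rwa [ofTrees_congr rfl rfl]

/-- The standard generators generate `F_n`, the subgroup of the elements `(T, Id, Id, T')`. -/
theorem ofTrees_mem (hH : ∀ i, genTree n i ∈ H) {m : ℕ} (T T' : NTree n)
    (h : T.leaves.length = m) (h' : T'.leaves.length = m) : ofTrees T T' h h' ∈ H := by
  have hn := Nat.AtLeastTwo.prop (n := n)
  obtain ⟨k, e, hk⟩ := ofTrees_comb_mem hH T
  obtain ⟨l, e', hl⟩ := ofTrees_comb_mem hH T'
  obtain rfl : k = l := by
    have : k * (n - 1) = l * (n - 1) := by omega
    exact Nat.eq_of_mul_eq_mul_right (by omega) this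
  obtain rfl : m = 1 + k * (n - 1) := by omega
  have := H.mul_mem (H.inv_mem hk) hl
  rwa [ofTrees_inv, ofTrees_mul] at this

end BV

/-! ### Labels on the strands -/

namespace Braid

variable {m : ℕ}

theorem collapse_eq_iff (d : ℕ) {i j : Fin m} (h : i ≠ j) (x : Fin (m + d)) :
    collapse d j x = i ↔ x = skip d j i := by
  refine ⟨fun hx => ?_, fun hx => hx ▸ collapse_skip d h⟩
  obtain ⟨q, hq, rfl⟩ | ⟨a, rfl⟩ := skip_or_blk d j x
  · rw [← hx, collapse_skip d hq]
  · exact absurd (hx.symm.trans (collapse_blk d j a)) h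

theorem insert_σ {n k : ℕ} (hk : k < n - 1) (r : Fin m) :
    insert n r (σ n k) = σ (m + (n - 1)) (r + k) := by
  rw [σ, dif_pos hk, insert_of]

/-- A label `g` on the strand ending at `r` comes from the label `k r * g * (k r)⁻¹` at its other
end `i`, when it moves along a braid with the permutation `p` and the labels `k`. -/
theorem conj_mulSingle_perm {n : ℕ} (p : Equiv.Perm (Fin m)) (k : Fin m → Braid n) (i r : Fin m)
    (hr : p r = i) (g : Braid n) :
    (fun x => (k x)⁻¹ * (Pi.mulSingle i (k r * g * (k r)⁻¹) : Fin m → Braid n) (p x) * k x) =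
      Pi.mulSingle r g := by
  funext x
  rcases eq_or_ne x r with rfl | hx
  · rw [hr]; simp [mul_assoc]
  · rw [Pi.mulSingle_eq_of_ne hx,
      Pi.mulSingle_eq_of_ne (fun e => hx (p.injective (e.trans hr.symm)))]
    simp

end Braid

namespace BV

variable {n : ℕ} [n.AtLeastTwo]

theorem mk_mul_mk_tuple {m : ℕ} {T T' T'' : NTree n} (h : T.leaves.length = m)
    (h' k : T'.leaves.length = m) (k' : T''.leaves.length = m) (β γ : Braid m)
    (l l' : Fin m → Braid n) :
    mk ⟨T, T', h, h', β, l⟩ * mk ⟨T', T'', k, k', γ, l'⟩ =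
      mk ⟨T, T'', h, k', β * γ, fun r => l (Braid.perm γ r) * l' r⟩ :=
  mk_mul_mk _ _ rfl

/-- The homomorphism `λ ↦ (T, Id, λ, T)`. -/
def labelHom {m : ℕ} (T : NTree n) (h : T.leaves.length = m) : (Fin m → Braid n) →* BV n where
  toFun l := mk ⟨T, T, h, h, 1, l⟩
  map_one' := mk_refl T h
  map_mul' l l' := by
    rw [mk_mul_mk_tuple]
    exact congrArg mk (TreePair.ext' rfl rfl (by simp) fun x => by simp)

/-- The homomorphism `β ↦ (T, β, Id, T)`. -/
def braidHom {m : ℕ} (T : NTree n) (h : T.leaves.length = m) : Braid m →* BV n where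
  toFun β := mk ⟨T, T, h, h, β, fun _ => 1⟩
  map_one' := mk_refl T h
  map_mul' l l' := by
    rw [mk_mul_mk_tuple]
    exact congrArg mk (TreePair.ext' rfl rfl rfl fun x => by simp)

theorem labelHom_apply {m : ℕ} (T : NTree n) (h : T.leaves.length = m) (l : Fin m → Braid n) :
    labelHom T h l = mk ⟨T, T, h, h, 1, l⟩ := rfl

theorem braidHom_apply {m : ℕ} (T : NTree n) (h : T.leaves.length = m) (β : Braid m) :
    braidHom T h β = mk ⟨T, T, h, h, β, fun _ => 1⟩ := rfl

theorem mk_eq_mul {m : ℕ} (T T' : NTree n) (h : T.leaves.length = m) (h' : T'.leaves.length = m)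
    (β : Braid m) (l : Fin m → Braid n) :
    mk ⟨T, T', h, h', β, l⟩ = braidHom T h β * ofTrees T T' h h' * labelHom T' h' l := by
  rw [braidHom_apply, labelHom_apply, ofTrees, mk_mul_mk_tuple, mk_mul_mk_tuple]
  exact congrArg mk (TreePair.ext' rfl rfl (by simp) fun x => by simp)

theorem labelHom_conj {m : ℕ} {T T' : NTree n} (h : T.leaves.length = m)
    (h' : T'.leaves.length = m) (l : Fin m → Braid n) :
    labelHom T' h' l = ofTrees T' T h' h * labelHom T h l * ofTrees T T' h h' := by
  rw [labelHom_apply, labelHom_apply, ofTrees, ofTrees, mk_mul_mk_tuple, mk_mul_mk_tuple]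
  exact congrArg mk (TreePair.ext' rfl rfl (by simp) fun x => by simp)

theorem braidHom_conj {m : ℕ} {T T' : NTree n} (h : T.leaves.length = m)
    (h' : T'.leaves.length = m) (β : Braid m) :
    braidHom T' h' β = ofTrees T' T h' h * braidHom T h β * ofTrees T T' h h' := by
  rw [braidHom_apply, braidHom_apply, ofTrees, ofTrees, mk_mul_mk_tuple, mk_mul_mk_tuple]
  exact congrArg mk (TreePair.ext' rfl rfl (by simp) fun x => by simp)

/-- Labels slide along the strands of a braid. -/
theorem labelHom_mul {m : ℕ} {T : NTree n} (h : T.leaves.length = m) (β : Braid m)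
    (l k : Fin m → Braid n) :
    labelHom T h l * mk ⟨T, T, h, h, β, k⟩ =
      mk ⟨T, T, h, h, β, k⟩ *
        labelHom T h fun r => (k r)⁻¹ * l (Braid.perm β r) * k r := by
  rw [labelHom_apply, labelHom_apply, mk_mul_mk_tuple, mk_mul_mk_tuple]
  exact congrArg mk (TreePair.ext' rfl rfl (by simp) fun x => by simp [mul_assoc])

theorem labelHom_mulSingle_expand {m : ℕ} {T : NTree n} (h : T.leaves.length = m) {i j : Fin m}
    (hij : i ≠ j) (g : Braid n) :
    labelHom T h (Pi.mulSingle i g) = labelHom (T.expand (T.leafAt h j))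
      (NTree.length_expand_leafAt _ _ _) (Pi.mulSingle (Braid.skip (n - 1) j i) g) := by
  refine (mk_expand _ j).trans (congrArg mk (TreePair.ext' ?_ rfl ?_ fun x => ?_))
  · simp [TreePair.topLeaf]
  · simp [Braid.cable_one, Pi.mulSingle_eq_of_ne hij.symm]
  · simp only [Pi.mulSingle_apply, Braid.collapse_eq_iff _ hij]

/-- A label at a leaf of `T` is a braid of the caret at this leaf, with the same label at each of
the leaves of this caret. -/
theorem labelHom_mulSingle_expand_self {m : ℕ} {T : NTree n} (h : T.leaves.length = m) (i : Fin m)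
    (g : Braid n) :
    labelHom T h (Pi.mulSingle i g) = mk ⟨T.expand (T.leafAt h i), T.expand (T.leafAt h i),
      NTree.length_expand_leafAt _ _ _, NTree.length_expand_leafAt _ _ _, Braid.insert n i g,
      fun x => Pi.mulSingle (M := fun _ => Braid n) i g (Braid.collapse (n - 1) i x)⟩ := by
  refine (mk_expand _ i).trans (congrArg mk (TreePair.ext' ?_ rfl ?_ fun x => ?_))
  · simp [TreePair.topLeaf]
  · simp [Braid.cable_one]
  · rfl

variable (H : Subgroup (BV n))

/-- The subgroup `H` contains the elements `(T, Id, λ, T)` for all trees `T` with `m` leaves and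
all labellings `λ` that are trivial except at the `i`-th leaf. -/
def LabelsAt (m i : ℕ) : Prop :=
  ∀ (T : NTree n) (h : T.leaves.length = m) (hi : i < m) (g : Braid n),
    labelHom T h (Pi.mulSingle ⟨i, hi⟩ g) ∈ H

/-- The subgroup `H` contains all elements `(T, Id, Id, T')`. -/
def ContainsTrees : Prop :=
  ∀ (m : ℕ) (T T' : NTree n) (h : T.leaves.length = m) (h' : T'.leaves.length = m),
    ofTrees T T' h h' ∈ H

variable {H}

theorem LabelsAt.of_tree (hF : ContainsTrees H) {m i : ℕ} (T : NTree n) (h : T.leaves.length = m)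
    (hi : i < m) (hg : ∀ g, labelHom T h (Pi.mulSingle ⟨i, hi⟩ g) ∈ H) : LabelsAt H m i := by
  intro T' h' hi' g
  rw [labelHom_conj h h']
  exact H.mul_mem (H.mul_mem (hF _ _ _ _ _) (hg g)) (hF _ _ _ _ _)

/-- Labels at the leaf `i` move along the strand of an element of `H` that starts at `i`. -/
theorem LabelsAt.conj (hF : ContainsTrees H) {m : ℕ} {T : NTree n} (h : T.leaves.length = m)
    {β : Braid m} {k : Fin m → Braid n} (hE : mk ⟨T, T, h, h, β, k⟩ ∈ H) {i r : Fin m}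
    (hr : Braid.perm β r = i) (hL : LabelsAt H m i) : LabelsAt H m r := by
  refine .of_tree hF T h r.isLt fun g => ?_
  have := labelHom_mul h β (Pi.mulSingle i (k r * g * (k r)⁻¹)) k
  rw [Braid.conj_mulSingle_perm _ _ _ _ hr, ← inv_mul_eq_iff_eq_mul] at this
  change labelHom T h (Pi.mulSingle r g) ∈ H
  rw [← this]
  exact H.mul_mem (H.inv_mem hE) (H.mul_mem (hL T h i.isLt _) hE)

/-- Expanding along the strand `j ≠ i` carries labels at the leaf `i` to larger trees. -/
theorem LabelsAt.lift (hF : ContainsTrees H) {m i j : ℕ} (hL : LabelsAt H m i) (hi : i < m)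
    (hj : j < m) (hij : i ≠ j) (T : NTree n) (h : T.leaves.length = m) :
    LabelsAt H (m + (n - 1)) (if i < j then i else i + (n - 1)) := by
  refine .of_tree hF (T.expand (T.leafAt h ⟨j, hj⟩)) (NTree.length_expand_leafAt _ _ _)
    (by split_ifs <;> omega) fun g => ?_
  have := hL T h hi g
  rwa [labelHom_mulSingle_expand h (j := ⟨j, hj⟩) (by simpa using hij)] at this

/-- The converse of `LabelsAt.lift`, for which no tree with `m` leaves has to be given. -/
theorem LabelsAt.drop {m i j : ℕ} (hj : j < m) (hij : i ≠ j)
    (hL : LabelsAt H (m + (n - 1)) (if i < j then i else i + (n - 1))) : LabelsAt H m i := by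
  intro T h hi g
  rw [labelHom_mulSingle_expand h (j := ⟨j, hj⟩) (by simpa using hij)]
  exact hL _ _ _ g

/-- Conjugation by the label `σ a` at the leaf `i` moves labels from the `a`-th to the `(a + 1)`-st
child of `i`. -/
theorem LabelsAt.sibling (hF : ContainsTrees H) {m i a : ℕ} (hL : LabelsAt H m i) (hi : i < m)
    (ha : a + 1 < n) (hLa : LabelsAt H (m + (n - 1)) (i + a)) (T : NTree n)
    (h : T.leaves.length = m) : LabelsAt H (m + (n - 1)) (i + (a + 1)) := by
  have hE := hL T h hi (Braid.σ n a)
  rw [labelHom_mulSingle_expand_self, Braid.insert_σ (by omega)] at hE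
  refine LabelsAt.conj (i := ⟨i + a, by omega⟩) (r := ⟨i + (a + 1), by omega⟩) hF _ hE ?_ hLa
  ext
  rw [Braid.perm_σ_val (by simp only; omega)]
  simp only
  split_ifs <;> omega

end BV

/-! ### The generated subgroup -/

namespace BV

variable {n : ℕ} [n.AtLeastTwo] {H : Subgroup (BV n)}

theorem LabelsAt.zero (hF : ContainsTrees H) (hL : LabelsAt H (1 + 1 * (n - 1)) 0) (k : ℕ)
    (hk : 1 ≤ k) : LabelsAt H (1 + k * (n - 1)) 0 := by
  have hn := Nat.AtLeastTwo.prop (n := n)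
  induction k, hk using Nat.le_induction with
  | base => exact hL
  | succ k hk ih =>
    have hkn : n - 1 ≤ k * (n - 1) := Nat.le_mul_of_pos_left _ hk
    have := ih.lift hF (j := 1) (by omega) (by omega) (by omega) (NTree.comb n k)
      (NTree.length_comb k)
    rwa [if_pos one_pos, show 1 + k * (n - 1) + (n - 1) = 1 + (k + 1) * (n - 1) by ring] at this

theorem LabelsAt.zero_child (hF : ContainsTrees H) (hL : LabelsAt H (1 + 1 * (n - 1)) 0) (a : ℕ)
    (ha : a < n) : LabelsAt H (1 + 2 * (n - 1)) a := by
  have e : 1 + 1 * (n - 1) + (n - 1) = 1 + 2 * (n - 1) := by ring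
  induction a with
  | zero => exact hL.zero hF 2 (by omega)
  | succ a ih =>
    have := hL.sibling hF (a := a) (by omega) ha (by rw [e, zero_add]; exact ih (by omega))
      (NTree.comb n 1) (NTree.length_comb 1)
    rwa [e, zero_add] at this

/-- All leaves of a tree with `k + 2` carets except the last `n - 1` are reached by going to larger
trees, where the leaf `i` is `i` again or `i + n - 1`. -/
theorem LabelsAt.of_le (hF : ContainsTrees H) (hL : LabelsAt H (1 + 1 * (n - 1)) 0) (k : ℕ) :
    ∀ i, i ≤ (k + 1) * (n - 1) → LabelsAt H (1 + (k + 2) * (n - 1)) i := by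
  have hn := Nat.AtLeastTwo.prop (n := n)
  induction k with
  | zero => exact fun i hi => hL.zero_child hF i (by omega)
  | succ k ih =>
    intro i hi
    have e : 1 + (k + 2) * (n - 1) + (n - 1) = 1 + (k + 1 + 2) * (n - 1) := by ring
    have e1 : (k + 1 + 1) * (n - 1) = (k + 1) * (n - 1) + (n - 1) := by ring
    have e2 : (k + 2) * (n - 1) = (k + 1) * (n - 1) + (n - 1) := by ring
    have e3 : (k + 1) * (n - 1) = k * (n - 1) + (n - 1) := by ring
    rcases le_or_gt i ((k + 1) * (n - 1)) with h | h
    · have := (ih i h).lift hF (j := (k + 2) * (n - 1)) (by omega) (by omega) (by omega)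
        (NTree.comb n (k + 2)) (NTree.length_comb _)
      rwa [if_pos (by omega), e] at this
    · have := (ih (i - (n - 1)) (by omega)).lift hF (j := 0) (by omega) (by omega) (by omega)
        (NTree.comb n (k + 2)) (NTree.length_comb _)
      rwa [if_neg (by omega), e, Nat.sub_add_cancel (by omega)] at this

/-- Labels at the first child of the root yield labels at all leaves but the last one. -/
theorem LabelsAt.of_lt (hF : ContainsTrees H) (hL : LabelsAt H (1 + 1 * (n - 1)) 0) (k : ℕ)
    (hk : 1 ≤ k) (i : ℕ) (hi : i < k * (n - 1)) : LabelsAt H (1 + k * (n - 1)) i := by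
  obtain ⟨k, rfl⟩ := Nat.exists_eq_add_of_le' hk
  -- the leaf is one of those reached by `of_le` after the last leaf is expanded
  refine .drop (j := (k + 1) * (n - 1)) (by omega) (by omega) ?_
  rw [if_pos hi, show 1 + (k + 1) * (n - 1) + (n - 1) = 1 + (k + 2) * (n - 1) by ring]
  exact hL.of_le hF k i hi.le

/-- Labels at the last leaf of a tree with two carets yield labels at the last leaf of all trees
with a caret. -/
theorem LabelsAt.last (hF : ContainsTrees H) (hL : LabelsAt H (1 + 2 * (n - 1)) (2 * (n - 1)))
    (k : ℕ) (hk : 1 ≤ k) : LabelsAt H (1 + k * (n - 1)) (k * (n - 1)) := by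
  have hn := Nat.AtLeastTwo.prop (n := n)
  induction k, hk using Nat.le_induction with
  | base =>
    refine .drop (j := 0) (by omega) (by omega) ?_
    rwa [if_neg (by omega), show 1 + 1 * (n - 1) + (n - 1) = 1 + 2 * (n - 1) by ring,
      show 1 * (n - 1) + (n - 1) = 2 * (n - 1) by ring]
  | succ k hk ih =>
    have hkn : n - 1 ≤ k * (n - 1) := Nat.le_mul_of_pos_left _ hk
    have := ih.lift hF (j := 0) (by omega) (by omega) (by omega) (NTree.comb n k)
      (NTree.length_comb k)
    rwa [if_neg (by omega), show 1 + k * (n - 1) + (n - 1) = 1 + (k + 1) * (n - 1) by ring,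
      show k * (n - 1) + (n - 1) = (k + 1) * (n - 1) by ring] at this

/-- The generators `genLabel` give all labels at the first leaf of the tree `R`, and so of
every tree with `n` leaves. -/
theorem labelsAt_first (hF : ContainsTrees H) (hG : ∀ j, genLabel n j ∈ H) : LabelsAt H n 0 := by
  refine .of_tree hF (treeR n) (length_treeR n) (NeZero.pos n) fun g => ?_
  induction g using Braid.induction_on with
  | one => rw [Pi.mulSingle_one, map_one]; exact H.one_mem
  | gen j =>
    convert hG j using 1
    rw [labelHom_apply, genLabel, Braid.of_eq_σ]
    exact congrArg mk (TreePair.ext' rfl rfl rfl fun x => by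
      simp only [Pi.mulSingle_apply, Fin.ext_iff])
  | mul α β hα hβ => rw [Pi.mulSingle_mul, map_mul]; exact H.mul_mem hα hβ
  | inv β hβ => rw [Pi.mulSingle_inv, map_inv]; exact H.inv_mem hβ

theorem labelsAt_all (hF : ContainsTrees H) (hG : ∀ j, genLabel n j ∈ H) (hB : genBraid n ∈ H)
    (k : ℕ) (hk : 1 ≤ k) (i : ℕ) (hi : i < 1 + k * (n - 1)) : LabelsAt H (1 + k * (n - 1)) i := by
  have hn := Nat.AtLeastTwo.prop (n := n)
  have h0 : LabelsAt H (1 + 1 * (n - 1)) 0 := by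
    rw [show 1 + 1 * (n - 1) = n by omega]
    exact labelsAt_first hF hG
  rcases Nat.lt_or_ge i (k * (n - 1)) with h | h
  · exact h0.of_lt hF k hk i h
  obtain rfl : i = k * (n - 1) := by omega
  refine LabelsAt.last hF ?_ k hk
  -- the generator `genBraid` carries the labels of the last leaf but one to the last leaf
  have h1 := h0.of_lt hF 2 (by omega) (2 * n - 3) (by omega)
  rw [show 1 + 2 * (n - 1) = n + (n - 1) by omega] at h1 ⊢
  refine LabelsAt.conj (r := ⟨2 * (n - 1), by omega⟩) (i := ⟨2 * n - 3, by omega⟩) hF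
    (length_treeR_expand _) hB ?_ h1
  ext
  rw [Braid.perm_σ_val (by omega)]
  simp only
  split_ifs <;> omega

theorem labelHom_mem (hF : ContainsTrees H) (hG : ∀ j, genLabel n j ∈ H) (hB : genBraid n ∈ H)
    {m : ℕ} (hm : n ≤ m) (T : NTree n) (h : T.leaves.length = m) (l : Fin m → Braid n) :
    labelHom T h l ∈ H := by
  have hn := Nat.AtLeastTwo.prop (n := n)
  obtain ⟨k, hk⟩ := T.exists_length_leaves
  obtain rfl : m = 1 + k * (n - 1) := h.symm.trans hk
  have hk1 : 1 ≤ k := by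
    rcases Nat.eq_zero_or_pos k with rfl | h0 <;> omega
  exact Subgroup.mem_comap.mp <| Subgroup.pi_mem_of_mulSingle_mem (H := H.comap (labelHom T h)) l
    fun i => labelsAt_all hF hG hB k hk1 i i.isLt T h i.isLt (l i)

/-- A braid generator is the braid of a caret, up to a change of trees, and so the quotient of a
label by the labels at the leaves of the caret. -/
theorem braidHom_mem (hF : ContainsTrees H) (hG : ∀ j, genLabel n j ∈ H) (hB : genBraid n ∈ H)
    {m : ℕ} (T : NTree n) (h : T.leaves.length = m) (hm : n ≤ m)
    (T' : NTree n) (h' : T'.leaves.length = m + (n - 1)) (β : Braid (m + (n - 1))) :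
    braidHom T' h' β ∈ H := by
  have hn := Nat.AtLeastTwo.prop (n := n)
  induction β using Braid.induction_on with
  | one => rw [map_one]; exact H.one_mem
  | gen j =>
    obtain ⟨i, a, hi, ha, hj⟩ : ∃ i a, i < m ∧ a < n - 1 ∧ j.val = i + a :=
      ⟨min j.val (m - 1), j.val - min j.val (m - 1), by omega, by omega, by omega⟩
    have hE := labelHom_mem hF hG hB hm T h (Pi.mulSingle ⟨i, hi⟩ (Braid.σ n a))
    rw [labelHom_mulSingle_expand_self, mk_eq_mul, ofTrees_self, mul_one, Braid.insert_σ ha] at hE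
    rw [Braid.of_eq_σ, hj, braidHom_conj (NTree.length_expand_leafAt T h ⟨i, hi⟩) h']
    refine H.mul_mem (H.mul_mem (hF _ _ _ _ _) ?_) (hF _ _ _ _ _)
    exact (H.mul_mem_cancel_right (labelHom_mem hF hG hB (by omega) _ _ _)).mp hE
  | mul α β hα hβ => rw [map_mul]; exact H.mul_mem hα hβ
  | inv β hβ => rw [map_inv]; exact H.inv_mem hβ

theorem mem_of_generators (hT : ∀ i, genTree n i ∈ H) (hB : genBraid n ∈ H)
    (hG : ∀ j, genLabel n j ∈ H) (x : BV n) : x ∈ H := by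
  have hn := Nat.AtLeastTwo.prop (n := n)
  have hF : ContainsTrees H := fun m T T' h h' => ofTrees_mem hT T T' h h'
  obtain ⟨m, a, rfl⟩ := exists_rep x
  have hm := a.dom.length_pos a.dom_leaves
  -- two expansions provide the `2 n - 1` strands at least that `braidHom_mem` needs
  rw [mk_expand a ⟨0, hm⟩, mk_expand _ ⟨0, by omega⟩]
  generalize hb : (a.expand ⟨0, hm⟩) = b
  generalize hc : b.expand ⟨0, by omega⟩ = c
  obtain ⟨T, T', h, h', β, l⟩ := c
  rw [mk_eq_mul]
  exact H.mul_mem (H.mul_mem (braidHom_mem hF hG hB b.dom b.dom_leaves (by omega) _ _ _)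
    (hF _ _ _ _ _)) (labelHom_mem hF hG hB (by omega) _ _ _)

end BV

/-! ### The action on words, and distinctness of the generators -/

namespace Braid

theorem perm_insert_val {m n : ℕ} (r : Fin m) (h : Braid n) :
    ∀ (a : Fin n) (x : Fin (m + (n - 1))), x.val = r + a →
      (perm (insert n r h) x).val = r + perm h a := by
  induction h using induction_on with
  | one => intro a x hx; simpa using hx
  | gen j =>
    intro a x hx
    have hj := j.isLt
    rw [insert_of, perm_σ_val (by omega), perm_of, swapAt_val]
    grind
  | mul α β hα hβ =>
    intro a x hx
    rw [map_mul, map_mul, Equiv.Perm.mul_apply, map_mul, Equiv.Perm.mul_apply]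
    exact hα _ _ (hβ a x hx)
  | inv β hβ =>
    intro a x hx
    have ha := (perm β⁻¹ a).isLt
    have hr := r.isLt
    have := hβ (perm β⁻¹ a) ⟨r + perm β⁻¹ a, by omega⟩ rfl
    rw [← Equiv.Perm.mul_apply, ← map_mul, mul_inv_cancel, map_one, Equiv.Perm.one_apply] at this
    have hx' : x = perm (insert n r β) ⟨r + perm β⁻¹ a, by omega⟩ := Fin.ext (hx.trans this.symm)
    rw [hx', ← Equiv.Perm.mul_apply, ← map_mul, ← map_mul, inv_mul_cancel, map_one, map_one]
    rfl

end Braid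

namespace NTree

variable {n : ℕ}

theorem eq_of_append_eq (T : NTree n) {v w s t : List (Fin n)} (hv : v ∈ T.leaves)
    (hw : w ∈ T.leaves) (h : v ++ s = w ++ t) : v = w ∧ s = t := by
  induction T generalizing v w with
  | leaf =>
    simp only [leaves, List.mem_singleton] at hv hw
    subst hv hw
    exact ⟨rfl, h⟩
  | node c ih =>
    cases v with
    | nil => exact absurd hv (nil_mem_leaves_node c)
    | cons k v =>
      cases w with
      | nil => exact absurd hw (nil_mem_leaves_node c)
      | cons l w =>
        rw [List.cons_append, List.cons_append] at h
        obtain ⟨rfl, h1⟩ := List.cons.inj h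
        obtain ⟨rfl, h2⟩ := ih k (cons_mem_leaves_node.mp hv) (cons_mem_leaves_node.mp hw) h1
        exact ⟨rfl, h2⟩

/-- Every long enough word passes through a leaf. -/
theorem exists_leaf_append (T : NTree n) : ∃ N, ∀ x : List (Fin n), N ≤ x.length →
    ∃ w ∈ T.leaves, ∃ t, x = w ++ t := by
  induction T with
  | leaf => exact ⟨0, fun x _ => ⟨[], by simp [leaves], x, rfl⟩⟩
  | node c ih =>
    choose N hN using ih
    refine ⟨∑ k, N k + 1, fun x hx => ?_⟩
    cases x with
    | nil => simp at hx
    | cons k x =>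
      have hk : N k ≤ ∑ k, N k :=
        Finset.single_le_sum (fun _ _ => Nat.zero_le _) (Finset.mem_univ k)
      obtain ⟨w, hw, t, rfl⟩ := hN k x (by simp only [List.length_cons] at hx; omega)
      exact ⟨k :: w, cons_mem_leaves_node.mpr hw, t, rfl⟩

/-- `leafAt_expand_blk` for a leaf that is given as a word. -/
theorem leafAt_expand_child (T : NTree n) {m : ℕ} (h : T.leaves.length = m) {w : List (Fin n)}
    (i : Fin m) (hw : T.leafAt h i = w) (a : Fin n)
    (h' : (T.expand w).leaves.length = m + (n - 1)) (x : Fin (m + (n - 1)))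
    (hx : x.val = i + a) : (T.expand w).leafAt h' x = w ++ [a] := by
  subst hw
  exact leafAt_expand_blk T h i a h' x hx

/-- `leafAt_expand_of_val` for a leaf that is given as a word. -/
theorem leafAt_expand_other [NeZero n] (T : NTree n) {m : ℕ} (h : T.leaves.length = m)
    {w : List (Fin n)} (i : Fin m) (hw : T.leafAt h i = w) (j : Fin m) (hij : j ≠ i)
    (h' : (T.expand w).leaves.length = m + (n - 1)) (x : Fin (m + (n - 1)))
    (hx : x.val = if j.val < i then j.val else j + (n - 1)) :
    (T.expand w).leafAt h' x = T.leafAt h j := by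
  subst hw
  exact leafAt_expand_of_val T h i j hij h' x hx

/-- The last leaf of a tree is the end of the rightmost path. -/
theorem exists_leafAt_last [n.AtLeastTwo] (T : NTree n) : ∀ {m : ℕ} (h : T.leaves.length = m)
    (i : Fin m), i.val + 1 = m → ∃ k, T.leafAt h i = rightWord n k := by
  have hn := Nat.AtLeastTwo.prop (n := n)
  induction steps_from_leaf T with
  | refl =>
    rintro m rfl i hi
    exact ⟨0, by simp [leafAt, leaves, rightWord]⟩
  | @tail S _ _ hs ih =>
    obtain ⟨w, hw, rfl⟩ := hs
    obtain ⟨j, hj⟩ := exists_leafAt S rfl hw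
    intro m h i hi
    obtain rfl : m = S.leaves.length + (n - 1) := by rw [← h, length_leaves_expand _ hw]
    have hj' := j.isLt
    rcases eq_or_ne (j.val + 1) S.leaves.length with e | e
    · obtain ⟨k, hk⟩ := ih rfl j e
      refine ⟨k + 1, ?_⟩
      rw [leafAt_expand_child S rfl j hj (lastLetter n) h i (by simp [lastLetter]; omega), ← hj, hk,
        rightWord, rightWord, List.replicate_succ']
    · obtain ⟨k, hk⟩ := ih rfl ⟨S.leaves.length - 1, by omega⟩ (by simp; omega)
      refine ⟨k, ?_⟩
      rw [← hk]
      exact leafAt_expand_other S rfl j hj _ (by simp [Fin.ext_iff]; omega) h i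
        (by rw [if_neg (by simp; omega)]; simp; omega)

end NTree

namespace TreePair

variable {n m : ℕ}

/-- The action of a braided tree pair on words, from bottom to top: the leaf `w'` of the range tree
at which a strand ends is replaced by the leaf `w` at which the strand starts, and the
permutation of the label of the strand is applied to all remaining letters. -/
def Maps (a : TreePair n m) (x y : List (Fin n)) : Prop :=
  ∃ r t, x = a.botLeaf r ++ t ∧ y = a.topLeaf r ++ t.map (Braid.perm (a.labels r))

theorem maps_append_iff (a : TreePair n m) (r : Fin m) (t y : List (Fin n)) :
    a.Maps (a.botLeaf r ++ t) y ↔ y = a.topLeaf r ++ t.map (Braid.perm (a.labels r)) := by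
  refine ⟨?_, fun h => ⟨r, t, rfl, h⟩⟩
  rintro ⟨q, s, h, rfl⟩
  obtain ⟨h1, rfl⟩ := a.ran.eq_of_append_eq (a.botLeaf_mem r) (a.botLeaf_mem q) h
  obtain rfl := NTree.leafAt_injective _ _ h1
  rfl

variable [NeZero n]

/-- Expansions restrict the action to longer words. -/
theorem maps_of_expand (a : TreePair n m) (r : Fin m) {x y : List (Fin n)}
    (h : (a.expand r).Maps x y) : a.Maps x y := by
  obtain ⟨s, t, rfl, rfl⟩ := h
  obtain ⟨q, hq, rfl⟩ | ⟨k, rfl⟩ := Braid.skip_or_blk (n - 1) r s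
  · refine ⟨q, t, by rw [botLeaf_expand a r q hq], ?_⟩
    rw [topLeaf_expand a r q hq]
    simp only [expand, Braid.collapse_skip _ hq]
  · have hn := NeZero.pos n
    have hk := k.isLt
    let c : Fin n := ⟨k, by omega⟩
    have hb : (a.expand r).botLeaf (Braid.blk (n - 1) r k) = a.botLeaf r ++ [c] :=
      NTree.leafAt_expand_blk _ _ r c _ _ rfl
    have ht : (a.expand r).topLeaf (Braid.blk (n - 1) r k) =
        a.topLeaf r ++ [Braid.perm (a.labels r) c] := by
      refine NTree.leafAt_expand_blk _ _ (Braid.perm a.braid r) _ _ _ ?_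
      have hp := (Braid.perm (a.labels r) c).isLt
      have : Braid.perm (Braid.insert n r (a.labels r)) (Braid.blk (n - 1) r k) =
          Braid.blk (n - 1) r ⟨Braid.perm (a.labels r) c, by omega⟩ :=
        Fin.ext (Braid.perm_insert_val r (a.labels r) c _ rfl)
      simp only [expand]
      rw [map_mul, Equiv.Perm.mul_apply, this, Braid.perm_cable_blk]
      rfl
    refine ⟨r, c :: t, by rw [hb]; simp, ?_⟩
    rw [ht]
    simp [expand, Braid.collapse_blk]

theorem maps_of_steps {a b : Σ m, TreePair n m} (h : Steps a b) {x y : List (Fin n)}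
    (hb : b.2.Maps x y) : a.2.Maps x y := by
  induction h using Relation.ReflTransGen.head_induction_on with
  | refl => exact hb
  | head h _ ih =>
    obtain ⟨r, rfl⟩ := h
    exact maps_of_expand _ r ih

end TreePair

namespace BV

variable {n : ℕ}

/-- Equivalent braided tree pairs have a common expansion. -/
theorem exists_common_of_mk_eq [NeZero n] {m m' : ℕ} {a : TreePair n m} {b : TreePair n m'}
    (h : mk a = mk b) : ∃ c, TreePair.Steps ⟨m, a⟩ c ∧ TreePair.Steps ⟨m', b⟩ c := by
  have hE := Relation.equivalence_join_reflTransGen (r := TreePair.Step (n := n)) (by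
    rintro ⟨m, a⟩ _ _ ⟨r, rfl⟩ ⟨q, rfl⟩
    rcases eq_or_ne q r with rfl | hq
    · exact ⟨_, .refl, .refl⟩
    · refine ⟨_, .single ⟨Braid.skip (n - 1) r q, rfl⟩,
        .single ⟨Braid.skip (n - 1) q r, ?_⟩⟩
      exact congrArg _ (TreePair.expand_expand a r q hq))
  exact hE.eqvGen_iff.mp ((Quot.eqvGen_exact h).mono fun x y hxy => ⟨y, .single hxy, .refl⟩)

/-- The element `u` is represented by a braided tree pair with a strand from the leaf `w` of the
domain tree to the leaf `w'` of the range tree, the label of which has the permutation `p`. -/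
def HasStrand [NeZero n] (u : BV n) (w w' : List (Fin n)) (p : Equiv.Perm (Fin n)) : Prop :=
  ∃ (m : ℕ) (a : TreePair n m) (r : Fin m),
    u = mk a ∧ a.topLeaf r = w ∧ a.botLeaf r = w' ∧ Braid.perm (a.labels r) = p

/-- The strands of two representatives act alike on all words that are long enough to pass through
the range tree of a common expansion. -/
theorem HasStrand.append_eq_append [NeZero n] {u : BV n} {w w' v v' : List (Fin n)}
    {p q : Equiv.Perm (Fin n)}
    (h : HasStrand u w w' p) (h' : HasStrand u v v' q) :
    ∃ N, ∀ t t', w' ++ t = v' ++ t' → N ≤ t.length → w ++ t.map p = v ++ t'.map q := by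
  obtain ⟨m, a, r, rfl, rfl, rfl, rfl⟩ := h
  obtain ⟨m', b, s, hab, rfl, rfl, rfl⟩ := h'
  obtain ⟨c, hc, hc'⟩ := exists_common_of_mk_eq hab
  obtain ⟨N, hN⟩ := c.2.ran.exists_leaf_append
  refine ⟨N, fun t t' ht hl => ?_⟩
  obtain ⟨x, hx, z, hz⟩ := hN (a.botLeaf r ++ t) (by simp; omega)
  obtain ⟨i, rfl⟩ := NTree.exists_leafAt _ c.2.ran_leaves hx
  have hM : c.2.Maps (a.botLeaf r ++ t) _ := ⟨i, z, hz, rfl⟩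
  have h1 := (a.maps_append_iff r t _).mp (TreePair.maps_of_steps hc hM)
  have h2 := TreePair.maps_of_steps hc' hM
  rw [ht] at h2
  exact h1.symm.trans ((b.maps_append_iff s t' _).mp h2)

variable [n.AtLeastTwo]

theorem hasStrand_ofTrees {m : ℕ} {T T' : NTree n} (h : T.leaves.length = m)
    (h' : T'.leaves.length = m) {i : Fin m} {w w' : List (Fin n)} (hw : T.leafAt h i = w)
    (hw' : T'.leafAt h' i = w') : HasStrand (ofTrees T T' h h') w w' 1 :=
  ⟨m, _, i, rfl, by simpa [TreePair.topLeaf] using hw, hw', map_one _⟩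

theorem hasStrand_genTree_last (i : Fin n) :
    ∃ k, HasStrand (genTree n i) (NTree.rightWord n (k + 1)) (NTree.rightWord n k) 1 := by
  have hn := Nat.AtLeastTwo.prop (n := n)
  have hR := NTree.leafAt_treeR (lastLetter n)
  have hl : (lastLetter n).val = n - 1 := rfl
  have h1 : ∀ x : Fin (n + (n - 1)), x.val = n + (n - 1) - 1 →
      ((treeR n).expand [lastLetter n]).leafAt (length_treeR_expand _) x =
        NTree.rightWord n 2 := fun x hx =>
    NTree.leafAt_expand_child _ _ _ hR (lastLetter n) _ x (by omega)
  unfold genTree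
  split_ifs with hi
  · refine ⟨1, hasStrand_ofTrees _ _ (i := ⟨n + (n - 1) - 1, by omega⟩) (h1 _ rfl) ?_⟩
    rw [NTree.leafAt_expand_other _ (length_treeR n) i (NTree.leafAt_treeR i) (lastLetter n)
      (by rw [Ne, Fin.ext_iff]; omega) _ _ (by rw [if_neg (by omega)]; simp only; omega), hR]
    rfl
  · have h2 : ((treeR n).expand [lastLetter n]).leafAt (length_treeR_expand _)
        ⟨n - 1, by omega⟩ = [lastLetter n, 0] :=
      NTree.leafAt_expand_child _ _ _ hR 0 _ _ (by simp [hl])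
    refine ⟨2, hasStrand_ofTrees _ _ (i := ⟨n + (n - 1) + (n - 1) - 1, by omega⟩) ?_ ?_⟩
    · exact NTree.leafAt_expand_child _ _ _ (h1 ⟨n + (n - 1) - 1, by omega⟩ rfl) (lastLetter n) _ _
        (by simp only; omega)
    · rw [NTree.leafAt_expand_other _ (length_treeR_expand _) _ h2
        ⟨n + (n - 1) - 1, by omega⟩ (by rw [Ne, Fin.ext_iff]; simp only; omega) _ _
        (by rw [if_neg (by simp only; omega)]; simp only; omega), h1 _ rfl]

theorem hasStrand_genBraid_last : ∃ k w, (∀ l, w ≠ NTree.rightWord n l) ∧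
    HasStrand (genBraid n) w (NTree.rightWord n k) 1 := by
  have hn := Nat.AtLeastTwo.prop (n := n)
  have hlen : (treeR' n).leaves.length = n + (n - 1) := length_treeR_expand _
  obtain ⟨k, hk⟩ := (treeR' n).exists_leafAt_last hlen ⟨2 * n - 2, by omega⟩ (by simp only; omega)
  refine ⟨k, (treeR' n).leafAt hlen ⟨2 * n - 3, by omega⟩, fun l hl => ?_,
    ⟨_, _, ⟨2 * n - 2, by omega⟩, rfl, ?_, hk, map_one _⟩⟩
  · -- two different leaves are not prefixes of the same word
    have h := (treeR' n).eq_of_append_eq (s := NTree.rightWord n k) (t := NTree.rightWord n l)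
      ((treeR' n).leafAt_mem hlen ⟨2 * n - 3, by omega⟩)
      ((treeR' n).leafAt_mem hlen ⟨2 * n - 2, by omega⟩) (by
        rw [hl, hk]; simp [NTree.rightWord, add_comm])
    have := Fin.ext_iff.mp (NTree.leafAt_injective _ _ h.1)
    simp only at this
    omega
  · have : Braid.perm (Braid.σ (n + (n - 1)) (2 * n - 3)) ⟨2 * n - 2, by omega⟩ =
        ⟨2 * n - 3, by omega⟩ := by
      ext
      rw [Braid.perm_σ_val (by omega)]
      simp only
      split_ifs <;> omega
    simp only [TreePair.topLeaf, this]

theorem hasStrand_genLabel_last (j : Fin (n - 1)) :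
    HasStrand (genLabel n j) (NTree.rightWord n 1) (NTree.rightWord n 1) 1 := by
  have hn := Nat.AtLeastTwo.prop (n := n)
  have hR := NTree.leafAt_treeR (lastLetter n)
  refine ⟨_, _, lastLetter n, rfl, ?_, hR, ?_⟩
  · simpa [TreePair.topLeaf, NTree.rightWord] using hR
  · simp only
    rw [if_neg (by simp [lastLetter]; omega), map_one]

theorem HasStrand.add_eq {u : BV n} {k l k' l' : ℕ}
    (h : HasStrand u (NTree.rightWord n l) (NTree.rightWord n k) 1)
    (h' : HasStrand u (NTree.rightWord n l') (NTree.rightWord n k') 1) : l + k' = l' + k := by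
  obtain ⟨N, hN⟩ := h.append_eq_append h'
  have := congrArg List.length (hN (NTree.rightWord n (N + k')) (NTree.rightWord n (N + k))
    (by simp [NTree.rightWord]; omega) (by simp [NTree.rightWord]))
  simp [NTree.rightWord] at this
  omega

theorem HasStrand.exists_rightWord {u : BV n} {k l k' : ℕ} {w : List (Fin n)}
    (h : HasStrand u (NTree.rightWord n l) (NTree.rightWord n k) 1)
    (h' : HasStrand u w (NTree.rightWord n k') 1) : ∃ l', w = NTree.rightWord n l' := by
  obtain ⟨N, hN⟩ := h.append_eq_append h'
  have := hN (NTree.rightWord n (N + k')) (NTree.rightWord n (N + k))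
    (by simp [NTree.rightWord]; omega) (by simp [NTree.rightWord])
  refine ⟨w.length, List.eq_replicate_iff.mpr ⟨rfl, fun c hc => ?_⟩⟩
  have hc' : c ∈ NTree.rightWord n l ++
      (NTree.rightWord n (N + k')).map (1 : Equiv.Perm (Fin n)) := by
    rw [this]; exact List.mem_append_left _ hc
  simp [NTree.rightWord] at hc'
  tauto

theorem genTree_ne_genBraid (i : Fin n) : genTree n i ≠ genBraid n := by
  intro e
  obtain ⟨k, hk⟩ := hasStrand_genTree_last i
  obtain ⟨k', w, hw, h⟩ := hasStrand_genBraid_last (n := n)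
  obtain ⟨l, hl⟩ := hk.exists_rightWord (e ▸ h)
  exact hw l hl

theorem genLabel_ne_genBraid (j : Fin (n - 1)) : genLabel n j ≠ genBraid n := by
  intro e
  obtain ⟨k', w, hw, h⟩ := hasStrand_genBraid_last (n := n)
  obtain ⟨l, hl⟩ := (hasStrand_genLabel_last j).exists_rightWord (e ▸ h)
  exact hw l hl

theorem genTree_ne_genLabel (i : Fin n) (j : Fin (n - 1)) : genTree n i ≠ genLabel n j := by
  intro e
  obtain ⟨k, hk⟩ := hasStrand_genTree_last i
  have := hk.add_eq (e ▸ hasStrand_genLabel_last j)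
  omega

theorem genTree_injective : Function.Injective (genTree n) := by
  have hn := Nat.AtLeastTwo.prop (n := n)
  have hl : (lastLetter n).val = n - 1 := rfl
  have hR := NTree.leafAt_treeR (lastLetter n)
  have h1 : ∀ i : Fin n, i.val < n - 1 → ∀ j : Fin n, i < j → ∀ x : Fin (n + (n - 1)),
      x.val = i → ((treeR n).expand [j]).leafAt (length_treeR_expand _) x = [i] := by
    intro i hi j hij x hx
    rw [NTree.leafAt_expand_other _ (length_treeR n) j (NTree.leafAt_treeR j) i hij.ne _ _
      (by rw [if_pos (by simpa using hij)]; exact hx), NTree.leafAt_treeR]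
  refine Function.Injective.of_lt_imp_ne ?_
  intro i j hij e
  have hij' : i.val < j.val := hij
  have hj' := j.isLt
  have hi : i.val < n - 1 := by omega
  have hil : i < lastLetter n := hi
  have A : HasStrand (genTree n i) [i] [i, 0] 1 := by
    rw [genTree, if_pos hi]
    refine hasStrand_ofTrees _ _ (i := ⟨i, by omega⟩) (h1 i hi _ hil _ rfl) ?_
    exact NTree.leafAt_expand_child _ _ _ (NTree.leafAt_treeR i) 0 _ _ (by simp)
  have B : HasStrand (genTree n j) [i] [i] 1 := by
    unfold genTree
    split_ifs with hj
    · exact hasStrand_ofTrees _ _ (i := ⟨i, by omega⟩) (h1 i hi _ hil _ rfl) (h1 i hi _ hij _ rfl)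
    · have h2 : ∀ a : Fin n, ((treeR n).expand [lastLetter n]).leafAt (length_treeR_expand _)
          ⟨n - 1 + a, by omega⟩ = [lastLetter n, a] := fun a =>
        NTree.leafAt_expand_child _ _ _ hR a _ _ (by simp [hl])
      have h3 : ∀ a : Fin n, (((treeR n).expand [lastLetter n]).expand [lastLetter n, a]).leafAt
          (length_treeR_expand_expand _) ⟨i, by omega⟩ = [i] := fun a => by
        rw [NTree.leafAt_expand_other _ (length_treeR_expand _) _ (h2 a) ⟨i, by omega⟩
          (by rw [Ne, Fin.ext_iff]; simp only; omega) _ _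
          (by rw [if_pos (by simp only; omega)]), h1 i hi _ hil _ rfl]
      exact hasStrand_ofTrees _ _ (h3 _) (h3 _)
  obtain ⟨N, hN⟩ := A.append_eq_append (e ▸ B)
  have := congrArg List.length (hN (List.replicate N 0) (0 :: List.replicate N 0) rfl (by simp))
  simp at this

theorem genLabel_injective : Function.Injective (genLabel n) := by
  have hn := Nat.AtLeastTwo.prop (n := n)
  have A : ∀ j : Fin (n - 1), HasStrand (genLabel n j) [0] [0] (Braid.perm (Braid.σ n j)) := by
    intro j
    have h0 := NTree.leafAt_treeR (0 : Fin n)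
    refine ⟨_, _, (0 : Fin n), rfl, ?_, h0, ?_⟩
    · simpa [TreePair.topLeaf] using h0
    · simp only
      rw [if_pos (by simp)]
  refine Function.Injective.of_lt_imp_ne ?_
  intro i j hij e
  have hij' : i.val < j.val := hij
  have hj := j.isLt
  obtain ⟨N, hN⟩ := (A i).append_eq_append (e ▸ A j)
  have := hN (List.replicate (N + 1) ⟨i, by omega⟩) (List.replicate (N + 1) ⟨i, by omega⟩) rfl
    (by simp)
  rw [List.map_replicate, List.map_replicate, List.append_cancel_left_eq, List.replicate_succ,
    List.replicate_succ] at this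
  have h := Fin.ext_iff.mp (List.cons.inj this).1
  rw [Braid.perm_σ_val (by omega), Braid.perm_σ_val (by omega)] at h
  simp only at h
  split_ifs at h <;> omega

theorem ncard_generators :
    (Set.range (genTree n) ∪ {genBraid n} ∪ Set.range (genLabel n)).ncard = 2 * n := by
  have hn := Nat.AtLeastTwo.prop (n := n)
  rw [Set.ncard_union_eq ?_ (Set.toFinite _) (Set.toFinite _), Set.ncard_union_eq ?_
    (Set.toFinite _) (Set.toFinite _), Set.ncard_singleton, Set.ncard_range_of_injective
    genTree_injective, Set.ncard_range_of_injective genLabel_injective, Nat.card_fin, Nat.card_fin]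
  · omega
  · rw [Set.disjoint_singleton_right]
    rintro ⟨i, hi⟩
    exact genTree_ne_genBraid i hi
  · rw [Set.disjoint_right]
    rintro _ ⟨j, rfl⟩ (⟨i, hi⟩ | hj)
    · exact genTree_ne_genLabel i j hi
    · exact genLabel_ne_genBraid j hj

end BV

theorem mainTheorem2 (n : ℕ) [n.AtLeastTwo] :
    (Set.range (genTree n) ∪ {genBraid n} ∪ Set.range (genLabel n)).ncard = 2 * n ∧
      Subgroup.closure (Set.range (genTree n) ∪ {genBraid n} ∪ Set.range (genLabel n)) = ⊤ := by
  refine ⟨BV.ncard_generators, (Subgroup.eq_top_iff' _).mpr (BV.mem_of_generators ?_ ?_ ?_)⟩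
  · exact fun i => Subgroup.subset_closure (.inl (.inl ⟨i, rfl⟩))
  · exact Subgroup.subset_closure (.inl (.inr rfl))
  · exact fun j => Subgroup.subset_closure (.inr ⟨j, rfl⟩)
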